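/- For integers $m\ge 1$, $b$ with $(b,m)=1$ and $Q\ge 1$ let $$\mathfrak F_Q^{(m,b)}=\Big\{\tfrac aq : 0<a\le q\le Q,\ (a,q)=1,\ q\equiv b \!\!\pmod m\Big\},$$ and put $$C_m=\frac{\varphi(m)}{\zeta(2)m}\prod_{p\mid m}\Big(1-\frac1{p^2}\Big)^{-1},\qquad g_{(m)}(\lambda)=\frac{\varphi(m)}{m}\cdot\frac{C_m}{\lambda^2}\sum_{1\le\Delta\le 2\lambda/C_m}\varphi(\Delta)\,\frac{(\Delta,m)}{\varphi((\Delta,m))}\,\log\frac{2\lambda}{C_m\Delta}\quad(\lambda>0).$$ For a finite set $F\subset\mathbb R$ with $N$ elements and an interval $I\subseteq\mathbb R$ let $$\mathcal G_F(I)=\frac1N\#\Big\{(x,y)\in F^2: y\ne x,\ y-x\in\tfrac1N I+\mathbb Z\Big\}.$$ The pair correlation measure of a sequence $(F_n)$ of finite sets is the measure $\mathcal G$ on $\mathbb R$ with $\mathcal G(I)=\lim_n\mathcal G_{F_n}(I)\in[0,\infty]$ for every interval $I$, if it exists; a function $g$ is the pair correlation function of $(F_n)$ if moreover $\mathcal G([0,\lambda])=\int_0^\lambda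 g(x)\,dx<\infty$ for all $\lambda\ge 0$. **Theorem.** Let $m\ge1$. For every integer $b$ with $(b,m)=1$ the pair correlation function of $(\mathfrak F_Q^{(m,b)})_{Q\ge1}$ exists; it does not depend on $b$ and is given by $$\widetilde g_{(m)}(\lambda)=g_{(m)}(\varphi(m)\lambda).$$ Moreover, for all $\delta>0$ and $K>0$, $$\frac1N\#\Big\{(\gamma,\gamma')\in F^2: 0<\gamma'-\gamma\le\frac{\lambda}{N}\Big\}=\int_0^\lambda\widetilde g_{(m)}(x)\,dx+O_{\delta,m,K}\big(Q^{-1/2+\delta}\big),\qquad F=\mathfrak F_Q^{(m,b)},\ N=\#F,$$ uniformly in $0\le\lambda\le K$, in $Q\ge1$ and in $b$ with $(b,m)=1$ (for the finitely many $Q$ with $F=\emptyset$ the left side is read as $0$), and the same holds with $\mathcal G_F([0,\lambda])$ on the left side. -/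

import Mathlib

open MeasureTheory Filter Topology

noncomputable section

namespace FareyPair

/-- `𝒢_F(I) = (1/N) #{(x,y) ∈ F² : y ≠ x, y - x ∈ (1/N) I + ℤ}`, where `N = #F`. -/
def pairCorr (F : Finset ℝ) (I : Set ℝ) : ℝ :=
  (1 / (F.card : ℝ)) *
    (Set.ncard {p : ℝ × ℝ | p.1 ∈ F ∧ p.2 ∈ F ∧ p.2 ≠ p.1 ∧
      ∃ t ∈ I, ∃ k : ℤ, p.2 - p.1 = t / (F.card : ℝ) + (k : ℝ)} : ℝ)

/-- `𝒢` is the pair correlation measure of the sequence `F`: `𝒢(I) = lim 𝒢_{F n}(I)` for every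
interval `I` of the real line, bounded or not (the limit is taken in `[0, ∞]`). -/
def IsPairCorrMeasure (F : ℕ → Finset ℝ) (𝒢 : Measure ℝ) : Prop :=
  ∀ I : Set ℝ, I.OrdConnected →
    Tendsto (fun n => ENNReal.ofReal (pairCorr (F n) I)) atTop (𝓝 (𝒢 I))

/-- The pair correlation measure of `F` exists and `g` is the pair correlation function of `F`:
`𝒢([0, L]) = ∫_0^L g` for all `L ≥ 0`, both sides being finite. -/
def HasPairCorrFunction (F : ℕ → Finset ℝ) (g : ℝ → ℝ) : Prop :=
  ∃ 𝒢 : Measure ℝ, IsPairCorrMeasure F 𝒢 ∧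
    ∀ L : ℝ, 0 ≤ L → 𝒢 (Set.Icc 0 L) < ⊤ ∧ IntervalIntegrable g volume 0 L ∧
      (𝒢 (Set.Icc 0 L)).toReal = ∫ x in (0 : ℝ)..L, g x

/-- `(1/N) #{(x,y) ∈ F² : 0 < y - x ≤ L/N}`, where `N = #F`. -/
def cumulCorr (F : Finset ℝ) (L : ℝ) : ℝ :=
  (1 / (F.card : ℝ)) *
    (Set.ncard {p : ℝ × ℝ | p.1 ∈ F ∧ p.2 ∈ F ∧
      0 < p.2 - p.1 ∧ p.2 - p.1 ≤ L / (F.card : ℝ)} : ℝ)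

/-- The Farey fractions `a/q` with `0 < a ≤ q ≤ Q`, `(a,q) = 1` and `q ≡ b (mod m)`. -/
def fareyMod (m : ℕ) (b : ℤ) (Q : ℕ) : Finset ℝ :=
  ((Finset.Icc 1 Q ×ˢ Finset.Icc 1 Q).filter (fun p : ℕ × ℕ =>
    p.1 ≤ p.2 ∧ Nat.Coprime p.1 p.2 ∧ (p.2 : ℤ) ≡ b [ZMOD (m : ℤ)])).image
      (fun p : ℕ × ℕ => (p.1 : ℝ) / (p.2 : ℝ))

/-- `C_m = φ(m) / (ζ(2) m) ∏_{p ∣ m} (1 - 1/p²)⁻¹`. -/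
def constC (m : ℕ) : ℝ :=
  (Nat.totient m : ℝ) / ((riemannZeta 2).re * (m : ℝ)) *
    ∏ p ∈ m.primeFactors, (1 - 1 / (p : ℝ) ^ 2)⁻¹

/-- `g_(m)(x) = (φ(m)/m) (C_m/x²) ∑_{1 ≤ Δ ≤ 2x/C_m} φ(Δ) ((Δ,m)/φ((Δ,m))) log(2x/(C_m Δ))`. -/
def gCoprime (m : ℕ) (x : ℝ) : ℝ :=
  (Nat.totient m : ℝ) / (m : ℝ) * (constC m / x ^ 2) *
    ∑ Δ ∈ Finset.Icc 1 ⌊2 * x / constC m⌋₊,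
      (Nat.totient Δ : ℝ) * ((Nat.gcd Δ m : ℝ) / (Nat.totient (Nat.gcd Δ m) : ℝ)) *
        Real.log (2 * x / (constC m * (Δ : ℝ)))

end FareyPair

end

namespace FareyPair

open scoped ArithmeticFunction.Moebius

/-! Put A = C_m/φ(m). Two fractions a/q < a'/q' differ by Δ/(qq') with Δ = a'q - aq' ≥ 1. A gap of
at most L/N means qq' ≥ ΔN/L, and N ~ AQ²/2, so Δ stays bounded for L ≤ K, and it suffices to count
pairs with a fixed Δ (`ncard_close_pairs_eq_sum`). Once LQ < N, every a in [1, q] with q ∣ aq' + Δ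
leads to a second fraction in (0, 1]. Thus a runs over complete residue systems, and no estimate for
exponential sums is needed.

A common divisor e of a' and q' divides Δ, so coprimality is removed by a Möbius sum over e ∣ Δ
(`pairCount_eq_sum`). What remains is to count units a mod q with ar ≡ -D, where q' = er and Δ = eD.
On average over r in a progression mod m this is φ(q)/q, whatever D is, with error O(D√q) in the sum
(`abs_sum_solCount_sub_le`). Summing over e produces the arithmetic factor `pairWeight m Δ`, equal
to (φ(Δ)/Δ)·(Δ,m)/φ((Δ,m)).

The admissible q' fill an interval of length Q(1 - T/q), T = ΔN/(LQ). As φ(q)/q has mean density A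
on the progression, partial summation (`abs_sum_totient_div_mul_sub_le`) turns the sum over q into A
times an integral, namely AQ²·`logPrim` (Q/T), where `logPrim` is the primitive of log y/y².
Dividing by N ~ AQ²/2 gives (2/m) ∑ `pairWeight`(Δ) `logPrim`(2L/(AΔ)), which is the integral of g
(`integral_gCoprime`). Every error is O(Q^(3/2)) against N ≍ Q²
(`abs_ncard_close_pairs_div_sub_le`), so the rate is Q^(-1/2).

Convergence on the intervals [0, L] passes to all intervals by symmetry, monotonicity and continuity
of the limit. Unbounded intervals get infinite mass because g has infinite integral
(`hasPairCorrFunction_of_tendsto`). -/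

/-! ### Residue classes in intervals and Möbius sums over divisors -/

/-- The number of solutions of `k * s ≡ b (mod m)` in a real interval, for `k` prime to `m`. -/
theorem abs_card_linear_congr_sub_le {m : ℕ} (hm : 0 < m) (b : ℤ) {k : ℕ} (hk : k.Coprime m)
    {α β : ℝ} (h0 : 0 ≤ α) (h : α ≤ β) :
    |(((Finset.Icc ⌈α⌉₊ ⌊β⌋₊).filter
      (fun s : ℕ => (k : ℤ) * s ≡ b [ZMOD m])).card : ℝ) - (β - α) / m| ≤ 3 := by
  obtain ⟨c, hc⟩ : ∃ c : ℤ, (k : ℤ) * c ≡ 1 [ZMOD m] := by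
    obtain ⟨u, v, huv⟩ := Nat.isCoprime_iff_coprime.2 hk
    exact ⟨u, (Int.modEq_iff_dvd.2 ⟨v, by linarith⟩)⟩
  obtain ⟨v, hv⟩ : ∃ v : ℕ, (v : ℤ) ≡ c * b [ZMOD m] := by
    refine ⟨((c * b) % m).toNat, ?_⟩
    rw [Int.toNat_of_nonneg (Int.emod_nonneg _ (by omega))]
    exact Int.mod_modEq _ _
  have hiff : ∀ s : ℕ, ((k : ℤ) * s ≡ b [ZMOD m]) ↔ s ≡ v [MOD m] := by
    intro s
    rw [← Int.natCast_modEq_iff]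
    constructor
    · intro hs
      have h1 : c * (k * s) ≡ c * b [ZMOD m] := hs.mul_left c
      have h2 : (k * c) * s ≡ 1 * s [ZMOD m] := hc.mul_right _
      have : (s : ℤ) ≡ c * (k * s) [ZMOD m] := by
        have := h2.symm
        rw [one_mul] at this
        convert this using 1; ring
      exact (this.trans h1).trans hv.symm
    · intro hs
      have h1 : (k : ℤ) * s ≡ k * (c * b) [ZMOD m] := (hs.trans hv).mul_left _
      have h2 : (k * c) * b ≡ 1 * b [ZMOD m] := hc.mul_right _
      rw [one_mul, mul_assoc] at h2
      exact h1.trans h2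
  have hset : (Finset.Icc ⌈α⌉₊ ⌊β⌋₊).filter (fun s : ℕ => (k : ℤ) * s ≡ b [ZMOD m]) =
      (Finset.Ico ⌈α⌉₊ (⌊β⌋₊ + 1)).filter (fun s : ℕ => s ≡ v [MOD m]) := by
    ext s
    simp only [Finset.mem_filter, Finset.mem_Icc, Finset.mem_Ico, hiff, Nat.lt_succ_iff]
  rw [hset]
  have hcard := Nat.Ico_filter_modEq_card ⌈α⌉₊ (⌊β⌋₊ + 1) hm v
  set n := ((Finset.Ico ⌈α⌉₊ (⌊β⌋₊ + 1)).filter (fun s : ℕ => s ≡ v [MOD m])).card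
  have hmR : (1 : ℝ) ≤ m := by exact_mod_cast hm
  have hm0 : (0 : ℝ) < m := by linarith
  set y : ℚ := (((⌊β⌋₊ + 1 : ℕ) : ℚ) - v) / m with hy
  set x : ℚ := ((⌈α⌉₊ : ℕ) - v : ℚ) / m with hx
  have hyR : (y : ℝ) * m = (⌊β⌋₊ : ℝ) + 1 - v := by
    rw [hy]; push_cast; field_simp
  have hxR : (x : ℝ) * m = (⌈α⌉₊ : ℝ) - v := by
    rw [hx]; push_cast; field_simp
  have a1 := Nat.le_ceil α
  have a2 := Nat.ceil_lt_add_one h0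
  have b1 := Nat.floor_le (h0.trans h)
  have b2 := Nat.lt_floor_add_one β
  have y1 : (y : ℝ) ≤ ⌈y⌉ := by exact_mod_cast Int.le_ceil y
  have y2 : (⌈y⌉ : ℝ) < y + 1 := by exact_mod_cast Int.ceil_lt_add_one y
  have x1 : (x : ℝ) ≤ ⌈x⌉ := by exact_mod_cast Int.le_ceil x
  have x2 : (⌈x⌉ : ℝ) < x + 1 := by exact_mod_cast Int.ceil_lt_add_one x
  have hn : (n : ℝ) = max ((⌈y⌉ : ℝ) - ⌈x⌉) 0 := by exact_mod_cast hcard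
  have hd : (y : ℝ) - x = ((⌊β⌋₊ : ℝ) + 1 - ⌈α⌉₊) / m := by
    rw [eq_div_iff hm0.ne']; linarith [sub_mul (y : ℝ) x m]
  -- Rounding the end points moves `y - x` by at most 1, and the two ceilings move it by less than
  -- 1; the constant 3 has slack.
  have u1 : (y : ℝ) - x ≤ (β - α) / m + 1 := by
    rw [hd, div_add_one hm0.ne']
    gcongr
    linarith
  have u2 : (β - α) / m - 1 ≤ (y : ℝ) - x := by
    rw [hd, div_sub_one hm0.ne']
    exact div_le_div_of_nonneg_right (by linarith) hm0.le
  have u3 : 0 ≤ (β - α) / m := div_nonneg (by linarith) hm0.le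
  rw [hn, abs_le]
  constructor
  · have := le_max_left ((⌈y⌉ : ℝ) - ⌈x⌉) 0
    linarith
  · have : max ((⌈y⌉ : ℝ) - ⌈x⌉) 0 ≤ (β - α) / m + 3 := max_le (by linarith) (by linarith)
    linarith

/-- Only squarefree divisors contribute. They are the divisors of the radical `r` of `n`, for which
the sum factors over primes. -/
theorem sum_divisors_moebius_mul {f : ArithmeticFunction ℝ} (hf : f.IsMultiplicative) {n : ℕ}
    (hn : n ≠ 0) :
    ∑ d ∈ n.divisors, (μ d : ℝ) * f d = ∏ p ∈ n.primeFactors, (1 - f p) := by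
  set r := ∏ p ∈ n.primeFactors, p with hr
  have hp : ∀ p ∈ n.primeFactors, p.Prime := fun p hp => Nat.prime_of_mem_primeFactors hp
  have hrf : r.primeFactors = n.primeFactors := Nat.primeFactors_prod hp
  have hrn : r ∣ n := Nat.prod_primeFactors_dvd n
  have hr0 : r ≠ 0 := fun h => hn (by simpa [h] using hrn)
  have hsq : Squarefree r := by
    rw [hr]
    refine Finset.squarefree_prod_of_pairwise_isCoprime ?_ fun p h => (hp p h).squarefree
    intro p h q h' hpq
    exact Nat.coprime_iff_isRelPrime.1 ((Nat.coprime_primes (hp p h) (hp q h')).2 hpq)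
  rw [← hrf, ArithmeticFunction.IsMultiplicative.prodPrimeFactors_one_sub_of_squarefree f hf hsq]
  symm
  refine Finset.sum_subset (Nat.divisors_subset_of_dvd hn hrn) fun d hd hdr => ?_
  have : ¬ Squarefree d := by
    intro hd2
    apply hdr
    rw [Nat.mem_divisors]
    refine ⟨?_, hr0⟩
    rw [← Nat.prod_primeFactors_of_squarefree hd2, hr]
    exact Finset.prod_dvd_prod_of_subset _ _ _
      (Nat.primeFactors_mono (Nat.dvd_of_mem_divisors hd) hn)
  rw [ArithmeticFunction.moebius_eq_zero_of_not_squarefree this]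
  simp

/-- The arithmetic function `n ↦ 1/n` on the integers prime to `m`, and `0` elsewhere. -/
noncomputable def invCoprime (m : ℕ) : ArithmeticFunction ℝ :=
  ⟨fun n => if n.Coprime m then (n : ℝ)⁻¹ else 0, by simp⟩

theorem invCoprime_apply (m n : ℕ) :
    invCoprime m n = if n.Coprime m then (n : ℝ)⁻¹ else 0 := rfl

theorem isMultiplicative_invCoprime (m : ℕ) : (invCoprime m).IsMultiplicative := by
  refine ⟨by simp [invCoprime_apply], fun {a c} _ => ?_⟩
  simp only [invCoprime_apply, Nat.coprime_mul_iff_left]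
  by_cases ha : a.Coprime m
  · by_cases hc : c.Coprime m
    · rw [if_pos ⟨ha, hc⟩, if_pos ha, if_pos hc, Nat.cast_mul, mul_inv]
    · rw [if_neg fun h => hc h.2, if_neg hc, mul_zero]
  · rw [if_neg fun h => ha h.1, if_neg ha, zero_mul]

theorem totient_div_self_eq_prod {n : ℕ} (hn : n ≠ 0) :
    (Nat.totient n : ℝ) / n = ∏ p ∈ n.primeFactors, (1 - (p : ℝ)⁻¹) := by
  have h := Nat.totient_eq_mul_prod_factors n
  have h2 : (Nat.totient n : ℝ) = n * ∏ p ∈ n.primeFactors, (1 - (p : ℝ)⁻¹) := by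
    have := congrArg (fun x : ℚ => (x : ℝ)) h
    push_cast at this
    exact this
  rw [h2]
  field_simp

theorem totient_div_self_eq_sum {n : ℕ} (hn : n ≠ 0) :
    (Nat.totient n : ℝ) / n = ∑ d ∈ n.divisors, (μ d : ℝ) / d := by
  have h := sum_divisors_moebius_mul (isMultiplicative_invCoprime 1) hn
  simp only [invCoprime_apply, Nat.coprime_one_right_eq_true, if_true] at h
  rw [totient_div_self_eq_prod hn, ← h]
  simp [div_eq_mul_inv]

/-- `∑_{e ∣ n, (e,m) = 1} μ(e)/e = (φ(n)/n) ((n,m)/φ((n,m)))`. -/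
theorem sum_divisors_moebius_invCoprime {m n : ℕ} (hm : m ≠ 0) (hn : n ≠ 0) :
    ∑ d ∈ n.divisors, (μ d : ℝ) * invCoprime m d =
      (Nat.totient n : ℝ) / n * ((Nat.gcd n m : ℝ) / Nat.totient (Nat.gcd n m)) := by
  rw [sum_divisors_moebius_mul (isMultiplicative_invCoprime m) hn]
  have hg : Nat.gcd n m ≠ 0 := Nat.gcd_ne_zero_left hn
  have hphi : (0 : ℝ) < Nat.totient (Nat.gcd n m) := by
    exact_mod_cast Nat.totient_pos.2 (Nat.pos_of_ne_zero hg)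
  have hg' : (0 : ℝ) < Nat.gcd n m := by exact_mod_cast Nat.pos_of_ne_zero hg
  rw [← inv_div (Nat.totient (Nat.gcd n m) : ℝ), ← div_eq_mul_inv, eq_div_iff (by positivity), totient_div_self_eq_prod hg,
    totient_div_self_eq_prod hn, Nat.primeFactors_gcd hn hm]
  rw [← Finset.filter_mem_eq_inter, Finset.prod_filter, ← Finset.prod_mul_distrib]
  refine Finset.prod_congr rfl fun p hp => ?_
  have hpp := Nat.prime_of_mem_primeFactors hp
  by_cases h : p ∣ m
  · have h1 : ¬ p.Coprime m := by rwa [hpp.coprime_iff_not_dvd, not_not]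
    simp [invCoprime_apply, h1, hpp, h, hm]
  · have h1 : p.Coprime m := by rwa [hpp.coprime_iff_not_dvd]
    simp [invCoprime_apply, h1, h]

/-! ### The density constant and the series ∑ μ(k)/k² over k prime to m -/

/-- The density of the weights `φ(q)/q` on the progression `q ≡ b (mod m)`. -/
noncomputable def weightDensity (m : ℕ) : ℝ := constC m / Nat.totient m

theorem weightDensity_mul {m : ℕ} (hm : 0 < m) :
    m * weightDensity m =
      ((∏ p ∈ m.primeFactors, (1 - 1 / (p : ℝ) ^ 2)) * (riemannZeta 2).re)⁻¹ := by
  have h1 : (0 : ℝ) < Nat.totient m := by exact_mod_cast Nat.totient_pos.2 hm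
  have h2 : (0 : ℝ) < m := by exact_mod_cast hm
  rw [weightDensity, constC, Finset.prod_inv_distrib, mul_inv]
  field_simp

theorem zeta_two_re_pos : 0 < (riemannZeta 2).re := by
  simpa using riemannZeta_re_pos_of_one_lt (x := 2) (by norm_num)

theorem constC_pos {m : ℕ} (hm : 0 < m) : 0 < constC m := by
  have h1 : (0 : ℝ) < Nat.totient m := by exact_mod_cast Nat.totient_pos.2 hm
  have h2 : (0 : ℝ) < m := by exact_mod_cast hm
  refine mul_pos (div_pos h1 (mul_pos zeta_two_re_pos h2)) (Finset.prod_pos fun p hp => ?_)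
  have hp : (1 : ℝ) < p := by exact_mod_cast (Nat.prime_of_mem_primeFactors hp).one_lt
  rw [inv_pos, sub_pos, div_lt_one (by positivity)]
  nlinarith

theorem weightDensity_pos {m : ℕ} (hm : 0 < m) : 0 < weightDensity m :=
  div_pos (constC_pos hm) (by exact_mod_cast Nat.totient_pos.2 hm)

/-- This is the Dirichlet series of μχ₀ at 2, with χ₀ the principal character mod m. It is the
inverse of L(2, χ₀), which is ζ(2) with the Euler factors at p ∣ m removed. -/
theorem hasSum_moebius_coprime {m : ℕ} (hm : 0 < m) :
    HasSum (fun k : ℕ => (μ k : ℝ) * invCoprime m k / k) (m * weightDensity m) := by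
  have : NeZero m := ⟨hm.ne'⟩
  have hs : (1 : ℝ) < (2 : ℂ).re := by norm_num
  have h1 := DirichletCharacter.LSeries.mul_mu_eq_one (1 : DirichletCharacter ℂ m) hs
  rw [← DirichletCharacter.LFunction_eq_LSeries _ hs] at h1
  have h2 := DirichletCharacter.LFunctionTrivChar_eq_mul_riemannZeta (N := m)
    (s := 2) (by norm_num)
  rw [DirichletCharacter.LFunctionTrivChar] at h2
  rw [h2] at h1
  have hz : riemannZeta 2 = ((riemannZeta 2).re : ℂ) := by
    apply Complex.ext
    · simp
    · simpa using riemannZeta_im_eq_zero_of_one_lt (x := 2) (by norm_num)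
  have hsum := (DirichletCharacter.LSeriesSummable_mul (1 : DirichletCharacter ℂ m)
    (ArithmeticFunction.LSeriesSummable_moebius_iff.2 hs)).hasSum
  have hval := eq_inv_of_mul_eq_one_right h1
  rw [LSeries] at hval
  rw [hval, hz] at hsum
  rw [weightDensity_mul hm]
  refine Complex.hasSum_ofReal.1 ?_
  convert hsum using 1
  · ext k
    rcases eq_or_ne k 0 with rfl | hk
    · simp
    rw [LSeries.term_of_ne_zero hk]
    simp only [Pi.mul_apply, invCoprime_apply]
    by_cases hkm : k.Coprime m
    · have : IsUnit (k : ZMod m) := (ZMod.isUnit_iff_coprime k m).2 hkm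
      rw [MulChar.one_apply this]
      rw [if_pos hkm]
      push_cast
      rw [show ((k : ℂ) ^ (2 : ℂ)) = (k : ℂ) ^ (2 : ℕ) by norm_cast]
      have : (k : ℂ) ≠ 0 := by exact_mod_cast hk
      field_simp
    · have : ¬ IsUnit (k : ZMod m) := fun h => hkm ((ZMod.isUnit_iff_coprime k m).1 h)
      rw [MulChar.map_nonunit _ this]
      simp [hkm]
  · push_cast
    congr 2
    refine Finset.prod_congr rfl fun p _ => ?_
    rw [Complex.cpow_neg, show ((p : ℂ) ^ (2 : ℂ)) = (p : ℂ) ^ (2 : ℕ) by norm_cast, one_div]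

/-- The number of multiples `r` of `t` in a real interval with `e * r ≡ b (mod m)`. -/
theorem abs_card_multiples_congr_sub_le {m : ℕ} (hm : 0 < m) (b : ℤ) {e t : ℕ} (ht : 0 < t)
    (h : (e * t).Coprime m) {α β : ℝ} (h0 : 0 ≤ α) (hαβ : α ≤ β) :
    |(((Finset.Icc ⌈α⌉₊ ⌊β⌋₊).filter
      (fun r : ℕ => t ∣ r ∧ (e : ℤ) * r ≡ b [ZMOD m])).card : ℝ) - (β - α) / (t * m)| ≤ 3 := by
  have ht' : (0 : ℝ) < t := by exact_mod_cast ht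
  have key := abs_card_linear_congr_sub_le hm b h (α := α / t) (β := β / t) (by positivity)
    (by gcongr)
  have hcard : ((Finset.Icc ⌈α⌉₊ ⌊β⌋₊).filter
      (fun r : ℕ => t ∣ r ∧ (e : ℤ) * r ≡ b [ZMOD m])).card =
      ((Finset.Icc ⌈α / t⌉₊ ⌊β / t⌋₊).filter
        (fun s : ℕ => ((e * t : ℕ) : ℤ) * s ≡ b [ZMOD m])).card := by
    symm
    -- Writing r = ts shrinks the interval by t and turns the congruence into one with coefficient
    -- et, still prime to m.
    refine Finset.card_bij (fun s _ => t * s) ?_ ?_ ?_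
    · intro s hs
      simp only [Finset.mem_filter, Finset.mem_Icc, Nat.ceil_le] at hs ⊢
      obtain ⟨⟨h1, h2⟩, h3⟩ := hs
      have h2' := (Nat.le_floor_iff (by have := h0.trans hαβ; positivity)).1 h2
      refine ⟨⟨?_, Nat.le_floor ?_⟩, dvd_mul_right _ _, ?_⟩
      · rw [div_le_iff₀ ht'] at h1; push_cast; linarith
      · rw [le_div_iff₀ ht'] at h2'; push_cast; linarith
      · push_cast at h3 ⊢; rwa [← mul_assoc]
    · intro s _ s' _ hss
      exact Nat.eq_of_mul_eq_mul_left ht hss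
    · intro r hr
      simp only [Finset.mem_filter, Finset.mem_Icc, Nat.ceil_le] at hr
      obtain ⟨⟨h1, h2⟩, ⟨s, rfl⟩, h3⟩ := hr
      have h2' := (Nat.le_floor_iff (h0.trans hαβ)).1 h2
      refine ⟨s, ?_, rfl⟩
      simp only [Finset.mem_filter, Finset.mem_Icc, Nat.ceil_le]
      push_cast at h1 h2' h3 ⊢
      refine ⟨⟨?_, Nat.le_floor ?_⟩, by rwa [mul_assoc]⟩
      · rw [div_le_iff₀ ht']; linarith
      · rw [le_div_iff₀ ht']; linarith
  rw [hcard]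
  convert key using 3
  field_simp

/-- Uses log n = 2 log √n ≤ 2(√n - 1). A square root is affordable here, and it keeps logarithms out
of the error terms. -/
theorem sum_Icc_inv_le_two_sqrt {n : ℕ} (hn : 1 ≤ n) :
    ∑ k ∈ Finset.Icc 1 n, ((k : ℝ))⁻¹ ≤ 2 * √n - 1 := by
  have h := harmonic_le_one_add_log n
  rw [harmonic_eq_sum_Icc] at h
  push_cast at h
  have hn' : (1 : ℝ) ≤ n := by exact_mod_cast hn
  have h2 := Real.log_le_sub_one_of_pos (Real.sqrt_pos.2 (by linarith : (0 : ℝ) < n))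
  rw [Real.log_sqrt (by linarith)] at h2
  linarith

theorem abs_invCoprime_le (m k : ℕ) : |invCoprime m k| ≤ (k : ℝ)⁻¹ := by
  rw [invCoprime_apply]
  split_ifs
  · rw [abs_of_nonneg (by positivity)]
  · simp

theorem abs_moebius_cast_le (k : ℕ) : |(μ k : ℝ)| ≤ 1 := by
  exact_mod_cast ArithmeticFunction.abs_moebius_le_one

/-- The tail is dominated by ∑ 1/k² over k > n. -/
theorem abs_sum_moebius_invCoprime_sub_le {m : ℕ} (hm : 0 < m) (n : ℕ) :
    |∑ k ∈ Finset.Icc 1 n, (μ k : ℝ) * invCoprime m k / k - m * weightDensity m| ≤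
      2 / (n + 1) := by
  have hs := (hasSum_moebius_coprime hm).tendsto_sum_nat
  have hlim : Tendsto (fun M : ℕ => |∑ k ∈ Finset.Icc 1 n, (μ k : ℝ) * invCoprime m k / k -
      ∑ k ∈ Finset.range M, (μ k : ℝ) * invCoprime m k / k|) atTop
      (𝓝 |∑ k ∈ Finset.Icc 1 n, (μ k : ℝ) * invCoprime m k / k - m * weightDensity m|) :=
    (tendsto_const_nhds.sub hs).abs
  refine le_of_tendsto hlim ?_
  filter_upwards [eventually_gt_atTop n] with M hM
  have hsub : Finset.Icc 1 n ⊆ Finset.range M := by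
    intro k hk; simp only [Finset.mem_Icc, Finset.mem_range] at hk ⊢; omega
  rw [abs_sub_comm, ← Finset.sum_sdiff_eq_sub hsub]
  have hle : ∑ k ∈ Finset.Ioo n M, (((k : ℝ)) ^ 2)⁻¹ ≤ 2 / (n + 1) := sum_Ioo_inv_sq_le n M
  refine le_trans (Finset.abs_sum_le_sum_abs _ _) (le_trans ?_ hle)
  refine le_trans (b := ∑ k ∈ Finset.range M \ Finset.Icc 1 n, (((k : ℝ)) ^ 2)⁻¹) ?_ ?_
  · refine Finset.sum_le_sum fun k _ => ?_
    rw [abs_div, abs_mul, Nat.abs_cast, div_eq_mul_inv, sq, mul_inv]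
    have h1 := abs_invCoprime_le m k
    have h2 := abs_moebius_cast_le k
    gcongr
    calc |(μ k : ℝ)| * |invCoprime m k| ≤ 1 * (k : ℝ)⁻¹ := by gcongr
      _ = _ := one_mul _
  · refine le_of_eq (Finset.sum_subset_zero_on_sdiff ?_ ?_ fun _ _ => rfl).symm
    · intro k hk
      simp only [Finset.mem_Ioo, Finset.mem_sdiff, Finset.mem_range, Finset.mem_Icc] at hk ⊢
      omega
    · intro k hk
      simp only [Finset.mem_Ioo, Finset.mem_sdiff, Finset.mem_range, Finset.mem_Icc] at hk
      have : k = 0 := by omega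
      simp [this]

/-! ### Averages of φ(q)/q along the progression -/

/-- The denominators `q ≤ Q` with `q ≡ b (mod m)`. -/
def denoms (m : ℕ) (b : ℤ) (Q : ℕ) : Finset ℕ :=
  (Finset.Icc 1 Q).filter fun q => (q : ℤ) ≡ b [ZMOD m]

theorem coprime_of_mul_modEq {m : ℕ} {b : ℤ} (hb : IsCoprime b (m : ℤ)) {k l : ℕ}
    (h : (k : ℤ) * l ≡ b [ZMOD m]) : k.Coprime m := by
  rw [← Nat.isCoprime_iff_coprime]
  obtain ⟨c, hc⟩ := Int.modEq_iff_dvd.1 h.symm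
  have : (k : ℤ) * l = b + m * c := by linarith
  have h2 : IsCoprime ((k : ℤ) * l) m := by
    rw [this]; exact IsCoprime.add_mul_left_left hb c
  exact h2.of_mul_left_left

theorem coprime_of_mem_denoms {m : ℕ} {b : ℤ} (hb : IsCoprime b (m : ℤ)) {Q q : ℕ}
    (h : q ∈ denoms m b Q) : q.Coprime m := by
  simp only [denoms, Finset.mem_filter] at h
  exact coprime_of_mul_modEq hb (l := 1) (by simpa using h.2)

/-- The mean value of `φ(q)/q` along a progression. -/
theorem abs_sum_totient_div_sub_le {m : ℕ} (hm : 0 < m) {b : ℤ} (hb : IsCoprime b (m : ℤ))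
    (n : ℕ) :
    |∑ q ∈ denoms m b n, (Nat.totient q : ℝ) / q - weightDensity m * n| ≤ 8 * √n := by
  rcases Nat.eq_zero_or_pos n with rfl | hn
  · simp [denoms]
  have hmR : (1 : ℝ) ≤ m := by exact_mod_cast hm
  have hnR : (1 : ℝ) ≤ n := by exact_mod_cast hn
  have h1 : ∑ q ∈ denoms m b n, (Nat.totient q : ℝ) / q =
      ∑ k ∈ Finset.Icc 1 n, (μ k : ℝ) / k * ((Finset.Icc ⌈(1 : ℝ)⌉₊ ⌊(n : ℝ)⌋₊).filter
      (fun r : ℕ => k ∣ r ∧ ((1 : ℕ) : ℤ) * r ≡ b [ZMOD m])).card := by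
    -- Expand φ(q)/q = ∑ μ(k)/k over k ∣ q and exchange the sums.
    have : ∀ q ∈ denoms m b n, (Nat.totient q : ℝ) / q =
        ∑ k ∈ Finset.Icc 1 n, if k ∣ q then (μ k : ℝ) / k else 0 := by
      intro q hq
      simp only [denoms, Finset.mem_filter, Finset.mem_Icc] at hq
      rw [totient_div_self_eq_sum (by omega), ← Finset.sum_filter]
      refine Finset.sum_congr ?_ fun _ _ => rfl
      ext k
      simp only [Nat.mem_divisors, Finset.mem_filter, Finset.mem_Icc]
      constructor
      · rintro ⟨h, h0⟩
        exact ⟨⟨Nat.pos_of_dvd_of_pos h (by omega), (Nat.le_of_dvd (by omega) h).trans hq.1.2⟩, h⟩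
      · rintro ⟨-, h⟩
        exact ⟨h, by omega⟩
    rw [Finset.sum_congr rfl this, Finset.sum_comm]
    refine Finset.sum_congr rfl fun k _ => ?_
    rw [← Finset.sum_filter, Finset.sum_const, nsmul_eq_mul, mul_comm]
    congr 3
    ext q
    simp only [denoms, Finset.mem_filter, Nat.ceil_one, Nat.floor_natCast]
    push_cast
    rw [one_mul]
    tauto
  have h2 : ∀ k ∈ Finset.Icc 1 n, |(μ k : ℝ) / k * ((Finset.Icc ⌈(1 : ℝ)⌉₊ ⌊(n : ℝ)⌋₊).filter
      (fun r : ℕ => k ∣ r ∧ ((1 : ℕ) : ℤ) * r ≡ b [ZMOD m])).card -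
      (n / m : ℝ) * ((μ k : ℝ) * invCoprime m k / k)| ≤ 4 * (k : ℝ)⁻¹ := by
    intro k hk
    rw [Finset.mem_Icc] at hk
    have hk1 : (1 : ℝ) ≤ k := by exact_mod_cast hk.1
    have hk0 : (0 : ℝ) < k := by linarith
    by_cases hkm : k.Coprime m
    · have key := abs_card_multiples_congr_sub_le hm b (e := 1) (t := k) hk.1 (by rwa [one_mul])
        (α := 1) (β := n) zero_le_one hnR
      set c := ((Finset.Icc ⌈(1 : ℝ)⌉₊ ⌊(n : ℝ)⌋₊).filter
        (fun r : ℕ => k ∣ r ∧ ((1 : ℕ) : ℤ) * r ≡ b [ZMOD m])).card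
      have : (μ k : ℝ) / k * c - (n / m : ℝ) * ((μ k : ℝ) * invCoprime m k / k) =
          (μ k : ℝ) * ((c - n / (k * m)) * (k : ℝ)⁻¹) := by
        rw [invCoprime_apply, if_pos hkm]
        field_simp
      rw [this, abs_mul, abs_mul, abs_inv, Nat.abs_cast]
      -- The interval [1, n] has length n - 1; replacing this by n costs 1/(km) ≤ 1 on top of the 3.
      have h3 : |(c : ℝ) - n / (k * m)| ≤ 4 := by
        have h4 : (1 : ℝ) / (k * m) ≤ 1 := by
          rw [div_le_one (by positivity)]; nlinarith
        have h5 : (0 : ℝ) ≤ 1 / (k * m) := by positivity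
        rw [sub_div] at key
        rw [abs_le] at key ⊢
        constructor <;> linarith [key.1, key.2]
      have h6 := abs_moebius_cast_le k
      calc _ ≤ 1 * (4 * (k : ℝ)⁻¹) := by gcongr
        _ = _ := one_mul _
    · have : ((Finset.Icc ⌈(1 : ℝ)⌉₊ ⌊(n : ℝ)⌋₊).filter
        (fun r : ℕ => k ∣ r ∧ ((1 : ℕ) : ℤ) * r ≡ b [ZMOD m])) = ∅ := by
        -- A `k` sharing a factor with `m` divides no element of the class, since `b` is prime to
        -- `m`.
        refine Finset.filter_eq_empty_iff.2 fun r _ hr => hkm ?_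
        obtain ⟨⟨s, rfl⟩, hr⟩ := hr
        exact coprime_of_mul_modEq hb (l := s) (by simpa using hr)
      rw [this, invCoprime_apply, if_neg hkm]
      simp
  have h3 := abs_sum_moebius_invCoprime_sub_le hm n
  have h4 := sum_Icc_inv_le_two_sqrt hn
  rw [h1]
  have h5 : |∑ k ∈ Finset.Icc 1 n, (μ k : ℝ) / k * ((Finset.Icc ⌈(1 : ℝ)⌉₊ ⌊(n : ℝ)⌋₊).filter
      (fun r : ℕ => k ∣ r ∧ ((1 : ℕ) : ℤ) * r ≡ b [ZMOD m])).card -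
      (n / m : ℝ) * ∑ k ∈ Finset.Icc 1 n, ((μ k : ℝ) * invCoprime m k / k)| ≤
      4 * (2 * √n - 1) := by
    rw [Finset.mul_sum, ← Finset.sum_sub_distrib]
    refine (Finset.abs_sum_le_sum_abs _ _).trans ((Finset.sum_le_sum h2).trans ?_)
    rw [← Finset.mul_sum]
    gcongr
  have h6 : |(n / m : ℝ) * ∑ k ∈ Finset.Icc 1 n, ((μ k : ℝ) * invCoprime m k / k) -
      weightDensity m * n| ≤ 2 := by
    have : (n / m : ℝ) * ∑ k ∈ Finset.Icc 1 n, ((μ k : ℝ) * invCoprime m k / k) -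
      weightDensity m * n = (n / m : ℝ) *
        (∑ k ∈ Finset.Icc 1 n, (μ k : ℝ) * invCoprime m k / k - m * weightDensity m) := by
      field_simp
    rw [this, abs_mul, abs_of_nonneg (by positivity)]
    calc (n / m : ℝ) * _ ≤ (n / 1) * (2 / (n + 1)) := by gcongr
      _ ≤ 2 := by
        rw [div_one, mul_div_assoc', div_le_iff₀ (by positivity)]; linarith
  have := (abs_sub_le _ _ _).trans (add_le_add h5 h6)
  linarith

/-- Summation by parts against a monotone function. -/
theorem abs_sum_mul_monotone_le {c : ℕ → ℝ} {E : ℝ} {n : ℕ}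
    (hc : ∀ k ≤ n, |∑ q ∈ Finset.Icc 1 k, c q| ≤ E) {f : ℝ → ℝ} (hf : Monotone f)
    (hf0 : ∀ x, 0 ≤ f x) :
    |∑ q ∈ Finset.Icc 1 n, c q * f q| ≤ 2 * E * f n := by
  have hE : 0 ≤ E := (abs_nonneg _).trans (hc 0 (Nat.zero_le _))
  -- Abel summation by induction: each step adds at most E times the increment of f.
  have key : ∀ k ≤ n, |∑ q ∈ Finset.Icc 1 k, c q * f q - (∑ q ∈ Finset.Icc 1 k, c q) * f k| ≤
      E * (f k - f 0) := by
    intro k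
    induction k with
    | zero => intro _; simp
    | succ k ih =>
      intro hk
      have ih := ih (by omega)
      have hk' := hc k (by omega)
      rw [Finset.sum_Icc_succ_top (by omega), Finset.sum_Icc_succ_top (by omega)]
      set S := ∑ q ∈ Finset.Icc 1 k, c q
      set R := ∑ q ∈ Finset.Icc 1 k, c q * f q
      have hmono : f (k : ℝ) ≤ f ((k + 1 : ℕ) : ℝ) := hf (by push_cast; linarith)
      have e1 : R + c (k + 1) * f ((k + 1 : ℕ) : ℝ) - (S + c (k + 1)) * f ((k + 1 : ℕ) : ℝ) =
          (R - S * f k) + S * (f k - f ((k + 1 : ℕ) : ℝ)) := by ring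
      rw [e1]
      refine (abs_add_le _ _).trans ?_
      rw [abs_mul, abs_of_nonpos (sub_nonpos.2 hmono)]
      nlinarith [mul_le_mul_of_nonneg_right hk' (sub_nonneg.2 hmono)]
  have h1 := key n le_rfl
  have h2 : |(∑ q ∈ Finset.Icc 1 n, c q) * f n| ≤ E * f n := by
    rw [abs_mul, abs_of_nonneg (hf0 n)]
    exact mul_le_mul_of_nonneg_right (hc n le_rfl) (hf0 _)
  have h3 := abs_add_le (∑ q ∈ Finset.Icc 1 n, c q * f q - (∑ q ∈ Finset.Icc 1 n, c q) * f n)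
    ((∑ q ∈ Finset.Icc 1 n, c q) * f n)
  rw [sub_add_cancel] at h3
  nlinarith [mul_nonneg hE (hf0 0)]

theorem abs_sum_sub_integral_le {f : ℝ → ℝ} (hf : Monotone f) (hf0 : ∀ x, 0 ≤ f x) (n : ℕ) :
    |∑ q ∈ Finset.Icc 1 n, f q - ∫ x in (0 : ℝ)..n, f x| ≤ f n := by
  have h1 := (hf.monotoneOn (Set.Icc (0 : ℝ) (0 + n))).sum_le_integral
  have h2 := (hf.monotoneOn (Set.Icc (0 : ℝ) (0 + n))).integral_le_sum
  simp only [zero_add] at h1 h2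
  have e : ∑ q ∈ Finset.Icc 1 n, f q = ∑ i ∈ Finset.range n, f ((i + 1 : ℕ) : ℝ) := by
    rw [Finset.range_eq_Ico, Finset.sum_Ico_add' (fun i : ℕ => f (i : ℝ)) 0 n 1]
    rfl
  have e2 : ∑ i ∈ Finset.range n, f ((i + 1 : ℕ) : ℝ) =
      ∑ i ∈ Finset.range n, f (i : ℝ) + f n - f 0 := by
    have a1 := Finset.sum_range_succ (fun i : ℕ => f (i : ℝ)) n
    have a2 := Finset.sum_range_succ' (fun i : ℕ => f (i : ℝ)) n
    simp only [Nat.cast_zero] at a2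
    linarith
  rw [← e] at h2
  rw [abs_le]
  constructor
  · linarith [hf0 n]
  · rw [e, e2]; linarith [hf0 0]

/-- The weight minus its mean A has partial sums of size at most 8√n, so Abel summation loses 16√n ·
f(n). Comparing A ∑ f(q) with the integral loses a further A f(n). -/
theorem abs_sum_totient_div_mul_sub_le {m : ℕ} (hm : 0 < m) {b : ℤ} (hb : IsCoprime b (m : ℤ))
    {f : ℝ → ℝ} (hf : Monotone f) (hf0 : ∀ x, 0 ≤ f x) (n : ℕ) :
    |∑ q ∈ denoms m b n, (Nat.totient q : ℝ) / q * f q -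
      weightDensity m * ∫ x in (0 : ℝ)..n, f x| ≤ (16 * √n + weightDensity m) * f n := by
  set A := weightDensity m
  have hA : 0 < A := weightDensity_pos hm
  set w : ℕ → ℝ := fun q => if (q : ℤ) ≡ b [ZMOD m] then (Nat.totient q : ℝ) / q else 0 with hw
  have h1 : ∀ k ≤ n, |∑ q ∈ Finset.Icc 1 k, (w q - A)| ≤ 8 * √n := by
    intro k hk
    have := abs_sum_totient_div_sub_le hm hb k
    rw [Finset.sum_sub_distrib, Finset.sum_const, Nat.card_Icc, nsmul_eq_mul, hw,
      ← Finset.sum_filter]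
    simp only [add_tsub_cancel_right]
    rw [mul_comm (k : ℝ)]
    refine this.trans ?_
    gcongr
  have h2 := abs_sum_mul_monotone_le h1 hf hf0
  have h3 := abs_sum_sub_integral_le hf hf0 n
  have e : ∑ q ∈ denoms m b n, (Nat.totient q : ℝ) / q * f q =
      ∑ q ∈ Finset.Icc 1 n, (w q - A) * f q + A * ∑ q ∈ Finset.Icc 1 n, f q := by
    rw [Finset.mul_sum, ← Finset.sum_add_distrib, denoms, Finset.sum_filter]
    refine Finset.sum_congr rfl fun q _ => ?_
    simp only [hw]
    split_ifs <;> ring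
  rw [e, add_sub_assoc, ← mul_sub]
  refine (abs_add_le _ _).trans ?_
  rw [abs_mul, abs_of_pos hA]
  nlinarith [mul_le_mul_of_nonneg_left h3 hA.le]

/-- The number of Farey fractions with denominator `≡ b (mod m)`, up to a power saving. -/
theorem abs_sum_totient_sub_le {m : ℕ} (hm : 0 < m) {b : ℤ} (hb : IsCoprime b (m : ℤ))
    (n : ℕ) :
    |∑ q ∈ denoms m b n, (Nat.totient q : ℝ) - weightDensity m * n ^ 2 / 2| ≤
      (16 * √n + weightDensity m) * n := by
  -- Take f(x) = x, cut off at 0 so that it is nonnegative on the whole line.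
  have h := abs_sum_totient_div_mul_sub_le hm hb (f := fun x => max x 0)
    (fun x y h => max_le_max h le_rfl) (fun x => le_max_right _ _) n
  have hn : (0 : ℝ) ≤ n := Nat.cast_nonneg n
  have e1 : ∫ x in (0 : ℝ)..n, max x 0 = n ^ 2 / 2 := by
    have : ∫ x in (0 : ℝ)..n, max x 0 = ∫ x in (0 : ℝ)..n, x := by
      refine intervalIntegral.integral_congr fun x hx => ?_
      rw [Set.uIcc_of_le hn] at hx
      exact max_eq_left hx.1
    rw [this, integral_id]; ring
  have e2 : ∑ q ∈ denoms m b n, (Nat.totient q : ℝ) / q * max (q : ℝ) 0 =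
      ∑ q ∈ denoms m b n, (Nat.totient q : ℝ) := by
    refine Finset.sum_congr rfl fun q hq => ?_
    simp only [denoms, Finset.mem_filter, Finset.mem_Icc] at hq
    have : (q : ℝ) ≠ 0 := by exact_mod_cast (by omega : q ≠ 0)
    rw [max_eq_left (Nat.cast_nonneg q)]
    field_simp
  simp only [max_eq_left hn, e1, e2] at h
  rwa [mul_div_assoc]

/-! ### Counting units with a prescribed linear congruence -/

theorem card_divisors_le_two_sqrt (n : ℕ) : (n.divisors.card : ℝ) ≤ 2 * √n := by
  have hsub : n.divisors ⊆ Finset.Icc 1 (Nat.sqrt n) ∪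
      (Finset.Icc 1 (Nat.sqrt n)).image (fun d => n / d) := by
    intro d hd
    rw [Nat.mem_divisors] at hd
    obtain ⟨⟨c, rfl⟩, h0⟩ := hd
    have hd0 : 0 < d := Nat.pos_of_ne_zero fun h => h0 (by simp [h])
    have hc0 : 0 < c := Nat.pos_of_ne_zero fun h => h0 (by simp [h])
    rw [Finset.mem_union, Finset.mem_image]
    rcases le_total d c with h | h
    · left
      rw [Finset.mem_Icc, Nat.le_sqrt]
      exact ⟨hd0, Nat.mul_le_mul_left _ h⟩
    · right
      refine ⟨c, ?_, Nat.mul_div_cancel _ hc0⟩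
      rw [Finset.mem_Icc, Nat.le_sqrt]
      exact ⟨hc0, Nat.mul_le_mul_right _ h⟩
  have h1 : n.divisors.card ≤ 2 * Nat.sqrt n := by
    refine (Finset.card_le_card hsub).trans ((Finset.card_union_le _ _).trans ?_)
    have := Finset.card_image_le (s := Finset.Icc 1 (Nat.sqrt n)) (f := fun d => n / d)
    simp only [Nat.card_Icc, add_tsub_cancel_right] at this ⊢
    omega
  have h2 : (n.divisors.card : ℝ) ≤ 2 * (Nat.sqrt n : ℝ) := by exact_mod_cast h1
  have := Real.nat_sqrt_le_real_sqrt (a := n)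
  linarith

theorem sum_divisors_moebius (n : ℕ) :
    ∑ f ∈ n.divisors, (μ f : ℝ) = if n = 1 then 1 else 0 := by
  have h := congrArg (fun F : ArithmeticFunction ℤ => F n) ArithmeticFunction.moebius_mul_coe_zeta
  simp only [ArithmeticFunction.coe_mul_zeta_apply, ArithmeticFunction.one_apply] at h
  exact_mod_cast h

/-- Reduction of units is a surjective homomorphism, so all its fibres have the same size. -/
theorem card_fiber_unitsMap_mul {n q : ℕ} [NeZero q] [NeZero n] (h : n ∣ q) (v : (ZMod n)ˣ) :
    ((Finset.univ : Finset (ZMod q)ˣ).filter (fun u => ZMod.unitsMap h u = v)).card *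
      Nat.totient n = Nat.totient q := by
  classical
  rw [← ZMod.card_units_eq_totient q, ← ZMod.card_units_eq_totient n]
  have h1 := Finset.card_eq_sum_card_fiberwise (s := (Finset.univ : Finset (ZMod q)ˣ))
    (t := (Finset.univ : Finset (ZMod n)ˣ)) (f := ZMod.unitsMap h) (fun _ _ => by simp)
  rw [Finset.card_univ] at h1
  rw [h1, Finset.sum_congr rfl fun w _ => MonoidHom.card_fiber_eq_of_mem_range (ZMod.unitsMap h)
    (ZMod.unitsMap_surjective h w) (ZMod.unitsMap_surjective h v)]
  rw [Finset.sum_const, Finset.card_univ, smul_eq_mul, mul_comm]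

/-- The number of `a` in `[1, q]` prime to `q` with `q ∣ a * r + D`. -/
def solCount (q r D : ℕ) : ℕ :=
  ((Finset.Icc 1 q).filter fun a => a.Coprime q ∧ q ∣ a * r + D).card

theorem exists_natCast_eq_of_zmod {q : ℕ} [NeZero q] (x : ZMod q) :
    ∃ a ∈ Finset.Icc 1 q, (a : ZMod q) = x := by
  have hq := NeZero.pos q
  have hlt := ZMod.val_lt x
  rcases Nat.eq_zero_or_pos x.val with h | h
  -- The class 0 is represented by `q`, since representatives run over [1, q].
  · exact ⟨q, by simp; omega, by rw [ZMod.natCast_self, eq_comm, ← ZMod.val_eq_zero, h]⟩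
  · exact ⟨x.val, by simp; omega, ZMod.natCast_zmod_val x⟩

theorem solCount_eq_card_units {q : ℕ} [NeZero q] (r D : ℕ) :
    solCount q r D = ((Finset.univ : Finset (ZMod q)ˣ).filter
      (fun u : (ZMod q)ˣ => (u : ZMod q) * r + D = 0)).card := by
  classical
  refine Finset.card_bij (fun a ha => ZMod.unitOfCoprime a (Finset.mem_filter.1 ha).2.1) ?_ ?_ ?_
  · intro a ha
    have h := (Finset.mem_filter.1 ha).2.2
    simp only [Finset.mem_filter, Finset.mem_univ, true_and, ZMod.coe_unitOfCoprime]
    exact_mod_cast (ZMod.natCast_eq_zero_iff _ _).2 h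
  · intro a ha a' ha' haa
    have h := congrArg (fun u : (ZMod q)ˣ => (u : ZMod q)) haa
    simp only [ZMod.coe_unitOfCoprime] at h
    rw [ZMod.natCast_eq_natCast_iff] at h
    have h1 := Finset.mem_Icc.1 (Finset.mem_filter.1 ha).1
    have h2 := Finset.mem_Icc.1 (Finset.mem_filter.1 ha').1
    have h3 := (Nat.modEq_iff_dvd.1 h)
    have h4 := Int.eq_zero_of_abs_lt_dvd h3 (by rw [abs_lt]; omega)
    omega
  · intro u hu
    simp only [Finset.mem_filter, Finset.mem_univ, true_and] at hu
    obtain ⟨a, ha, hau⟩ := exists_natCast_eq_of_zmod (u : ZMod q)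
    have hc : a.Coprime q := (ZMod.isUnit_iff_coprime a q).1 (hau ▸ u.isUnit)
    refine ⟨a, ?_, Units.ext hau⟩
    rw [Finset.mem_filter]
    refine ⟨ha, hc, ?_⟩
    rw [← ZMod.natCast_eq_zero_iff]
    push_cast
    rw [hau, hu]

/-- As a is prime to q, (ar, q) = (r, q), while q ∣ ar + D forces (ar, q) = (D, q). -/
theorem solCount_eq_zero {q r D : ℕ} (h : Nat.gcd r q ≠ Nat.gcd D q) : solCount q r D = 0 := by
  rw [solCount, Finset.card_eq_zero, Finset.filter_eq_empty_iff]
  rintro a - ⟨hc, hd⟩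
  apply h
  have h1 : Nat.gcd (a * r) q = Nat.gcd r q := Nat.Coprime.gcd_mul_left_cancel r hc
  rw [← h1]
  apply Nat.dvd_antisymm
  · refine Nat.dvd_gcd ?_ (Nat.gcd_dvd_right _ _)
    exact (Nat.dvd_add_right (Nat.gcd_dvd_left _ _)).1 ((Nat.gcd_dvd_right _ _).trans hd)
  · refine Nat.dvd_gcd ?_ (Nat.gcd_dvd_right _ _)
    exact (Nat.dvd_add_left (Nat.gcd_dvd_left _ _)).1 ((Nat.gcd_dvd_right _ _).trans hd)

/-- After division by d = (D, q) both coefficients are units mod q/d. The solutions are then the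
units mod q over a single unit class mod q/d. -/
theorem solCount_mul_totient {q r D : ℕ} (hq : 0 < q)
    (h : Nat.gcd r q = Nat.gcd D q) :
    solCount q r D * Nat.totient (q / Nat.gcd D q) = Nat.totient q := by
  have : NeZero q := ⟨hq.ne'⟩
  set d := Nat.gcd D q with hd
  have hd0 : 0 < d := Nat.gcd_pos_of_pos_right _ hq
  obtain ⟨n, hn⟩ : d ∣ q := Nat.gcd_dvd_right _ _
  obtain ⟨D', hD⟩ : d ∣ D := Nat.gcd_dvd_left _ _
  obtain ⟨r', hr⟩ : d ∣ r := h ▸ Nat.gcd_dvd_left _ _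
  have hqd : q / d = n := by rw [hn]; exact Nat.mul_div_cancel_left _ hd0
  have hn0 : NeZero n := ⟨fun h0 => hq.ne' (by rw [hn, h0, mul_zero])⟩
  have hDn : D'.Coprime n := by
    have : d * Nat.gcd D' n = d * 1 := by rw [← Nat.gcd_mul_left, ← hD, ← hn, mul_one]
    exact Nat.eq_of_mul_eq_mul_left hd0 this
  have hrn : r'.Coprime n := by
    have : d * Nat.gcd r' n = d * 1 := by rw [← Nat.gcd_mul_left, ← hr, ← hn, mul_one, h]
    exact Nat.eq_of_mul_eq_mul_left hd0 this
  have hnq : n ∣ q := ⟨d, by rw [hn, mul_comm]⟩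
  rw [hqd, solCount_eq_card_units,
    ← card_fiber_unitsMap_mul hnq (-(ZMod.unitOfCoprime D' hDn) * (ZMod.unitOfCoprime r' hrn)⁻¹)]
  congr 2
  ext u
  simp only [Finset.mem_filter, Finset.mem_univ, true_and]
  obtain ⟨a, -, hau⟩ := exists_natCast_eq_of_zmod (u : ZMod q)
  rw [eq_mul_inv_iff_mul_eq, ← Units.val_inj]
  simp only [Units.val_mul, Units.val_neg, ZMod.coe_unitOfCoprime, ZMod.unitsMap_val]
  rw [← hau, ZMod.cast_natCast hnq, eq_neg_iff_add_eq_zero]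
  have e1 : ((a : ZMod q) * r + D = 0) ↔ q ∣ a * r + D := by
    rw [← ZMod.natCast_eq_zero_iff]; push_cast; rfl
  have e2 : ((a : ZMod n) * r' + D' = 0) ↔ n ∣ a * r' + D' := by
    rw [← ZMod.natCast_eq_zero_iff]; push_cast; rfl
  rw [e1, e2, hr, hD, hn, show a * (d * r') + d * D' = d * (a * r' + D') by ring]
  exact Nat.mul_dvd_mul_iff_left hd0

/-- Residues prime to dn are prime to n, and [0, dn) is covered by d + 1 periods of n. Used to bound
φ(q)/φ(q/d). -/
theorem totient_mul_le (d n : ℕ) (hn : 0 < n) :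
    Nat.totient (d * n) ≤ Nat.totient n * (d + 1) := by
  have h := Nat.Ico_filter_coprime_le (a := n) 0 (d * n) hn.ne'
  rw [Nat.mul_div_cancel _ hn] at h
  refine le_trans ?_ h
  rw [Nat.totient_eq_card_coprime, zero_add, ← Finset.range_eq_Ico]
  refine Finset.card_le_card fun a ha => ?_
  rw [Finset.mem_filter] at ha ⊢
  exact ⟨ha.1, Nat.Coprime.coprime_dvd_left (dvd_mul_left n d) ha.2⟩

/-- The mean value of `solCount q r D` over `r` in an interval with `e * r ≡ b (mod m)`. -/
theorem abs_sum_solCount_sub_le {m : ℕ} (hm : 0 < m) (b : ℤ) {e q D : ℕ} (he : e.Coprime m)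
    (hq : 0 < q) (hqm : q.Coprime m) (hD : 0 < D) {α β : ℝ} (h0 : 0 ≤ α) (hαβ : α ≤ β) :
    |∑ r ∈ (Finset.Icc ⌈α⌉₊ ⌊β⌋₊).filter (fun r : ℕ => (e : ℤ) * r ≡ b [ZMOD m]),
      (solCount q r D : ℝ) - (β - α) / m * ((Nat.totient q : ℝ) / q)| ≤ 12 * D * √q := by
  set d := Nat.gcd D q with hd
  have hd0 : 0 < d := Nat.gcd_pos_of_pos_right _ hq
  obtain ⟨n, hn⟩ : d ∣ q := Nat.gcd_dvd_right _ _
  have hqd : q / d = n := by rw [hn]; exact Nat.mul_div_cancel_left _ hd0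
  have hn0 : 0 < n := Nat.pos_of_ne_zero fun h => hq.ne' (by rw [hn, h, mul_zero])
  have hphi : (0 : ℝ) < Nat.totient n := by exact_mod_cast Nat.totient_pos.2 hn0
  have hmR : (0 : ℝ) < m := by exact_mod_cast hm
  have hnR : (0 : ℝ) < n := by exact_mod_cast hn0
  have hdR : (0 : ℝ) < d := by exact_mod_cast hd0
  -- The value of `solCount q r D` whenever it is allowed to be nonzero, that is, when (r, q) = d.
  set κ : ℝ := (Nat.totient q : ℝ) / Nat.totient n with hκ
  have hκ0 : 0 ≤ κ := by positivity
  have hκ2 : κ ≤ 2 * D := by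
    rw [hκ, div_le_iff₀ hphi]
    have h1 := totient_mul_le d n hn0
    rw [← hn] at h1
    have h2 : (Nat.totient q : ℝ) ≤ Nat.totient n * (d + 1) := by exact_mod_cast h1
    have h3 : (d : ℝ) ≤ D := by exact_mod_cast Nat.gcd_le_left _ hD
    have h4 : (1 : ℝ) ≤ D := by exact_mod_cast hD
    nlinarith
  set J := (Finset.Icc ⌈α⌉₊ ⌊β⌋₊).filter (fun r : ℕ => (e : ℤ) * r ≡ b [ZMOD m])
  -- The condition (r, q) = d says r = dr' with (r', n) = 1, which a Möbius sum over f ∣ n detects.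
  have hpt : ∀ r, (solCount q r D : ℝ) =
      κ * ∑ f ∈ n.divisors, (μ f : ℝ) * if d * f ∣ r then 1 else 0 := by
    intro r
    by_cases hdr : d ∣ r
    · obtain ⟨r', rfl⟩ := hdr
      have hinner : ∑ f ∈ n.divisors, (μ f : ℝ) * (if d * f ∣ d * r' then 1 else 0) =
          if Nat.gcd r' n = 1 then 1 else 0 := by
        rw [← sum_divisors_moebius]
        simp only [mul_ite, mul_one, mul_zero]
        rw [← Finset.sum_filter]
        refine Finset.sum_congr ?_ fun _ _ => rfl
        ext f
        simp only [Finset.mem_filter, Nat.mem_divisors, Nat.dvd_gcd_iff,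
          Nat.mul_dvd_mul_iff_left hd0]
        have : Nat.gcd r' n ≠ 0 := Nat.gcd_ne_zero_right hn0.ne'
        have := hn0.ne'
        tauto
      rw [hinner]
      have hg : Nat.gcd (d * r') q = d * Nat.gcd r' n := by rw [← Nat.gcd_mul_left, ← hn]
      by_cases h : Nat.gcd r' n = 1
      · have := solCount_mul_totient (r := d * r') (D := D) hq (by rw [hg, h, mul_one])
        rw [← hd, hqd] at this
        rw [if_pos h, mul_one, hκ, eq_div_iff hphi.ne']
        exact_mod_cast this
      · rw [if_neg h, solCount_eq_zero]
        · simp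
        · rw [hg, ← hd]
          intro h'
          exact h (Nat.eq_of_mul_eq_mul_left hd0 (by rw [h', mul_one]))
    · rw [solCount_eq_zero]
      · rw [Finset.sum_eq_zero, mul_zero, Nat.cast_zero]
        intro f _
        rw [if_neg fun h => hdr ((dvd_mul_right _ _).trans h), mul_zero]
      · intro h
        exact hdr ((h.trans hd.symm) ▸ Nat.gcd_dvd_left r q)
  have hsum : ∑ r ∈ J, (solCount q r D : ℝ) = κ * ∑ f ∈ n.divisors, (μ f : ℝ) *
      ((Finset.Icc ⌈α⌉₊ ⌊β⌋₊).filter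
        (fun r : ℕ => d * f ∣ r ∧ (e : ℤ) * r ≡ b [ZMOD m])).card := by
    rw [Finset.sum_congr rfl fun r _ => hpt r, ← Finset.mul_sum, Finset.sum_comm]
    congr 1
    refine Finset.sum_congr rfl fun f _ => ?_
    rw [← Finset.mul_sum, ← Finset.sum_filter, Finset.sum_const, nsmul_eq_mul, mul_one,
      Finset.filter_filter]
    congr 4
    ext r
    tauto
  -- The dependence on D cancels: (φ(q)/φ(n)) · (1/d) · (φ(n)/n) = φ(q)/q because q = dn.
  have hmain : (β - α) / m * ((Nat.totient q : ℝ) / q) =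
      κ * ∑ f ∈ n.divisors, (μ f : ℝ) * ((β - α) / ((d * f : ℕ) * m)) := by
    have : ∑ f ∈ n.divisors, (μ f : ℝ) * ((β - α) / ((d * f : ℕ) * m)) =
        (β - α) / (d * m) * ∑ f ∈ n.divisors, (μ f : ℝ) / f := by
      rw [Finset.mul_sum]
      refine Finset.sum_congr rfl fun f hf => ?_
      have : (f : ℝ) ≠ 0 := by exact_mod_cast (Nat.pos_of_mem_divisors hf).ne'
      push_cast
      field_simp
    rw [this, ← totient_div_self_eq_sum hn0.ne', hκ]
    have : (q : ℝ) = d * n := by exact_mod_cast hn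
    rw [this]
    field_simp
  rw [hsum, hmain, ← mul_sub, ← Finset.sum_sub_distrib, abs_mul, abs_of_nonneg hκ0]
  have hbd : |∑ f ∈ n.divisors, ((μ f : ℝ) * ((Finset.Icc ⌈α⌉₊ ⌊β⌋₊).filter
        (fun r : ℕ => d * f ∣ r ∧ (e : ℤ) * r ≡ b [ZMOD m])).card -
        (μ f : ℝ) * ((β - α) / ((d * f : ℕ) * m)))| ≤ n.divisors.card * 3 := by
    rw [← nsmul_eq_mul]
    refine (Finset.abs_sum_le_sum_abs _ _).trans (Finset.sum_le_card_nsmul _ _ _ fun f hf => ?_)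
    have hfn := Nat.dvd_of_mem_divisors hf
    have hf0 := Nat.pos_of_mem_divisors hf
    have hcop : (e * (d * f)).Coprime m := by
      refine Nat.Coprime.mul_left he (Nat.Coprime.coprime_dvd_left ?_ hqm)
      rw [hn]; exact Nat.mul_dvd_mul_left _ hfn
    have key := abs_card_multiples_congr_sub_le hm b (Nat.mul_pos hd0 hf0) hcop h0 hαβ
    rw [← mul_sub, abs_mul]
    calc _ ≤ 1 * (3 : ℝ) := mul_le_mul (abs_moebius_cast_le f) key (abs_nonneg _) zero_le_one
      _ = 3 := one_mul _
  have hdiv := card_divisors_le_two_sqrt n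
  have hsq : √(n : ℝ) ≤ √(q : ℝ) := by
    apply Real.sqrt_le_sqrt
    exact_mod_cast Nat.le_of_dvd hq ⟨d, by rw [hn, mul_comm]⟩
  calc κ * _ ≤ (2 * D) * ((2 * √q) * 3) := by
        refine mul_le_mul hκ2 (hbd.trans ?_) (abs_nonneg _) (by positivity)
        linarith
    _ = 12 * D * √q := by ring

/-! ### Pairs of fractions with a given determinant -/

/-- The number of reduced fractions `a / q`, `a ∈ [1, q]`, such that `a / q + Δ / (q * q')` is a
reduced fraction with denominator `q'`. -/
def pairCount (q q' Δ : ℕ) : ℕ :=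
  ((Finset.Icc 1 q).filter fun a =>
    a.Coprime q ∧ q ∣ a * q' + Δ ∧ ((a * q' + Δ) / q).Coprime q').card

/-- With a' = (aq' + Δ)/q, a common divisor e of a' and q' divides qa' - aq' = Δ. For q' = er and Δ
= eD, the conditions q ∣ aq' + Δ and e ∣ a' together amount to q ∣ ar + D. -/
theorem pairCount_eq_sum {q Δ : ℕ} (q' : ℕ) (hq : 0 < q) (hΔ : 0 < Δ) :
    (pairCount q q' Δ : ℝ) = ∑ e ∈ Δ.divisors,
      if e ∣ q' then (μ e : ℝ) * solCount q (q' / e) (Δ / e) else 0 := by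
  set S := (Finset.Icc 1 q).filter fun a => a.Coprime q ∧ q ∣ a * q' + Δ with hS
  have hind : ∀ a ∈ S, (if ((a * q' + Δ) / q).Coprime q' then (1 : ℝ) else 0) =
      ∑ e ∈ Δ.divisors, if e ∣ q' ∧ e ∣ (a * q' + Δ) / q then (μ e : ℝ) else 0 := by
    intro a ha
    have hdvd := (Finset.mem_filter.1 ha).2.2
    obtain ⟨a', ha'⟩ := hdvd
    rw [ha', Nat.mul_div_cancel_left _ hq]
    have ha'0 : a' ≠ 0 := by rintro rfl; omega
    rw [← Finset.sum_filter]
    have := sum_divisors_moebius (Nat.gcd a' q')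
    rw [← this]
    refine Finset.sum_congr ?_ fun _ _ => rfl
    ext e
    simp only [Nat.mem_divisors, Finset.mem_filter, Nat.dvd_gcd_iff]
    have hg : Nat.gcd a' q' ≠ 0 := Nat.gcd_ne_zero_left ha'0
    constructor
    · rintro ⟨⟨h1, h2⟩, -⟩
      refine ⟨⟨?_, hΔ.ne'⟩, h2, h1⟩
      have h3 : e ∣ a * q' + Δ := ha' ▸ h1.mul_left q
      exact (Nat.dvd_add_right (h2.mul_left a)).1 h3
    · rintro ⟨-, h2, h1⟩
      exact ⟨⟨h1, h2⟩, hg⟩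
  have h1 : (pairCount q q' Δ : ℝ) =
      ∑ a ∈ S, if ((a * q' + Δ) / q).Coprime q' then (1 : ℝ) else 0 := by
    rw [← Finset.sum_filter, Finset.sum_const, nsmul_eq_mul, mul_one, hS, Finset.filter_filter,
      pairCount]
    simp only [and_assoc]
  rw [h1, Finset.sum_congr rfl hind, Finset.sum_comm]
  refine Finset.sum_congr rfl fun e he => ?_
  obtain ⟨D, rfl⟩ := Nat.dvd_of_mem_divisors he
  have he0 := Nat.pos_of_mem_divisors he
  by_cases heq : e ∣ q'
  · obtain ⟨r, rfl⟩ := heq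
    rw [if_pos (dvd_mul_right _ _), Nat.mul_div_cancel_left _ he0, Nat.mul_div_cancel_left _ he0,
      ← Finset.sum_filter, Finset.sum_const, nsmul_eq_mul, mul_comm]
    congr 2
    rw [hS, Finset.filter_filter, solCount]
    congr 1
    ext a
    simp only [Finset.mem_filter, dvd_mul_right, true_and]
    refine and_congr_right fun _ => ?_
    rw [and_assoc]
    refine and_congr_right fun _ => ?_
    rw [show a * (e * r) + e * D = e * (a * r + D) by ring]
    constructor
    · rintro ⟨⟨c, hc⟩, hd⟩
      rw [hc, Nat.mul_div_cancel_left _ hq] at hd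
      obtain ⟨c', rfl⟩ := hd
      refine ⟨c', Nat.eq_of_mul_eq_mul_left he0 ?_⟩
      rw [hc]; ring
    · rintro ⟨c, hc⟩
      rw [hc, show e * (q * c) = q * (e * c) by ring, Nat.mul_div_cancel_left _ hq]
      exact ⟨dvd_mul_right _ _, dvd_mul_right _ _⟩
  · rw [if_neg heq]
    exact Finset.sum_eq_zero fun a _ => if_neg fun h => heq h.1

theorem sum_pairCount_eq (m : ℕ) (b : ℤ) (Q : ℕ) {q Δ : ℕ} (hq : 0 < q) (hΔ : 0 < Δ) {α : ℝ}
    (hα : 0 < α) :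
    ∑ q' ∈ (denoms m b Q).filter (fun q' : ℕ => α ≤ q'), (pairCount q q' Δ : ℝ) =
      ∑ e ∈ Δ.divisors, (μ e : ℝ) *
        ∑ r ∈ (Finset.Icc ⌈α / e⌉₊ ⌊(Q : ℝ) / e⌋₊).filter
          (fun r : ℕ => (e : ℤ) * r ≡ b [ZMOD m]), (solCount q r (Δ / e) : ℝ) := by
  rw [Finset.sum_congr rfl fun q' _ => pairCount_eq_sum q' hq hΔ, Finset.sum_comm]
  refine Finset.sum_congr rfl fun e he => ?_
  have he0 := Nat.pos_of_mem_divisors he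
  have heR : (0 : ℝ) < e := by exact_mod_cast he0
  rw [← Finset.sum_filter, Finset.mul_sum]
  symm
  refine Finset.sum_bij (fun r _ => e * r) ?_ ?_ ?_ ?_
  · intro r hr
    simp only [Finset.mem_filter, Finset.mem_Icc, Nat.ceil_le, denoms] at hr ⊢
    obtain ⟨⟨h1, h2⟩, h3⟩ := hr
    have h2' := (Nat.le_floor_iff (by positivity)).1 h2
    rw [div_le_iff₀ heR] at h1
    rw [le_div_iff₀ heR] at h2'
    have h4 : e * r ≤ Q := by rw [mul_comm]; exact_mod_cast h2'
    -- Positivity of the lower end point α excludes r = 0.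
    have h5 : 0 < e * r := by
      have : (0 : ℝ) < r * e := by linarith
      rw [mul_comm]; exact_mod_cast this
    refine ⟨⟨⟨⟨h5, h4⟩, by push_cast; exact h3⟩, by push_cast; linarith⟩, dvd_mul_right _ _⟩
  · intro r _ r' _ h
    exact Nat.eq_of_mul_eq_mul_left he0 h
  · intro q' hq'
    simp only [Finset.mem_filter, Finset.mem_Icc, denoms] at hq'
    obtain ⟨⟨⟨⟨-, h1⟩, h2⟩, h3⟩, r, rfl⟩ := hq'
    refine ⟨r, ?_, rfl⟩
    simp only [Finset.mem_filter, Finset.mem_Icc, Nat.ceil_le]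
    have h1' : (e : ℝ) * r ≤ Q := by exact_mod_cast h1
    push_cast at h2 h3
    refine ⟨⟨?_, Nat.le_floor ?_⟩, h2⟩
    · rw [div_le_iff₀ heR]; linarith
    · rw [le_div_iff₀ heR]; linarith
  · intro r _
    rw [Nat.mul_div_cancel_left _ he0]

/-- The coefficient `∑_{e ∣ Δ, (e,m) = 1} μ(e)/e`. -/
noncomputable def pairWeight (m Δ : ℕ) : ℝ := ∑ e ∈ Δ.divisors, (μ e : ℝ) * invCoprime m e

theorem abs_sum_pairCount_sub_le {m : ℕ} (hm : 0 < m) {b : ℤ} (hb : IsCoprime b (m : ℤ)) {Q : ℕ}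
    {q Δ : ℕ} (hq : 0 < q) (hqm : q.Coprime m) (hΔ : 0 < Δ) {α : ℝ} (hα : 0 < α)
    (hαQ : α ≤ Q) :
    |∑ q' ∈ (denoms m b Q).filter (fun q' : ℕ => α ≤ q'), (pairCount q q' Δ : ℝ) -
      pairWeight m Δ * ((Q - α) / m * ((Nat.totient q : ℝ) / q))| ≤ 12 * Δ ^ 2 * √q := by
  rw [sum_pairCount_eq m b Q hq hΔ hα, pairWeight, Finset.sum_mul, ← Finset.sum_sub_distrib]
  have hcard : (Δ.divisors.card : ℝ) ≤ Δ := by exact_mod_cast Nat.card_divisors_le_self Δ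
  have hterm : ∀ e ∈ Δ.divisors, |(μ e : ℝ) *
        ∑ r ∈ (Finset.Icc ⌈α / e⌉₊ ⌊(Q : ℝ) / e⌋₊).filter
          (fun r : ℕ => (e : ℤ) * r ≡ b [ZMOD m]), (solCount q r (Δ / e) : ℝ) -
        (μ e : ℝ) * invCoprime m e * ((Q - α) / m * ((Nat.totient q : ℝ) / q))| ≤
        12 * Δ * √q := by
    intro e he
    have he0 := Nat.pos_of_mem_divisors he
    have heR : (0 : ℝ) < e := by exact_mod_cast he0
    have hmu := abs_moebius_cast_le e
    rw [mul_assoc, ← mul_sub, abs_mul]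
    by_cases hem : e.Coprime m
    · have hD : 0 < Δ / e := Nat.div_pos (Nat.le_of_dvd hΔ (Nat.dvd_of_mem_divisors he)) he0
      have key := abs_sum_solCount_sub_le hm b hem hq hqm hD (α := α / e) (β := Q / e)
        (by positivity) (by gcongr)
      have hD2 : ((Δ / e : ℕ) : ℝ) ≤ Δ := by exact_mod_cast Nat.div_le_self _ _
      have e1 : ((Q : ℝ) / e - α / e) / m * ((Nat.totient q : ℝ) / q) =
          invCoprime m e * ((Q - α) / m * ((Nat.totient q : ℝ) / q)) := by
        rw [invCoprime_apply, if_pos hem]; field_simp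
      rw [e1] at key
      calc _ ≤ 1 * (12 * ((Δ / e : ℕ) : ℝ) * √q) :=
            mul_le_mul hmu key (abs_nonneg _) zero_le_one
        _ ≤ 12 * Δ * √q := by rw [one_mul]; gcongr
    · have : (Finset.Icc ⌈α / e⌉₊ ⌊(Q : ℝ) / e⌋₊).filter
          (fun r : ℕ => (e : ℤ) * r ≡ b [ZMOD m]) = ∅ :=
        Finset.filter_eq_empty_iff.2 fun r _ hr => hem (coprime_of_mul_modEq hb hr)
      rw [this, invCoprime_apply, if_neg hem]
      simp only [Finset.sum_empty, zero_mul, sub_zero, abs_zero, mul_zero]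
      positivity
  refine (Finset.abs_sum_le_sum_abs _ _).trans
    ((Finset.sum_le_card_nsmul _ _ _ hterm).trans ?_)
  rw [nsmul_eq_mul]
  calc _ ≤ (Δ : ℝ) * (12 * Δ * √q) := by gcongr
    _ = _ := by ring

/-! ### Farey fractions and the enumeration of close pairs -/

theorem eq_of_div_eq_div_of_coprime {a q c d : ℕ} (hq : 0 < q) (hd : 0 < d) (h1 : a.Coprime q)
    (h2 : c.Coprime d) (h : (a : ℝ) / q = c / d) : a = c ∧ q = d := by
  have hqR : (q : ℝ) ≠ 0 := by exact_mod_cast hq.ne'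
  have hdR : (d : ℝ) ≠ 0 := by exact_mod_cast hd.ne'
  rw [div_eq_div_iff hqR hdR] at h
  have h' : a * d = c * q := by exact_mod_cast h
  have h3 : q ∣ d := h1.symm.dvd_of_dvd_mul_left (h' ▸ dvd_mul_left q c)
  have h4 : d ∣ q := h2.symm.dvd_of_dvd_mul_left (h' ▸ dvd_mul_left d a)
  have h5 : q = d := Nat.dvd_antisymm h3 h4
  subst h5
  exact ⟨Nat.eq_of_mul_eq_mul_right hq h', rfl⟩

theorem mem_fareyMod {m : ℕ} {b : ℤ} {Q : ℕ} {x : ℝ} :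
    x ∈ fareyMod m b Q ↔
      ∃ a q : ℕ, 1 ≤ a ∧ a ≤ q ∧ q ∈ denoms m b Q ∧ a.Coprime q ∧ (a : ℝ) / q = x := by
  simp only [fareyMod, denoms, Finset.mem_image, Finset.mem_filter, Finset.mem_product,
    Finset.mem_Icc, Prod.exists]
  constructor
  · rintro ⟨a, q, ⟨⟨⟨h1, h2⟩, h3, h4⟩, h5, h6, h7⟩, h8⟩
    exact ⟨a, q, h1, h5, ⟨⟨h3, h4⟩, h7⟩, h6, h8⟩
  · rintro ⟨a, q, h1, h2, ⟨⟨h3, h4⟩, h7⟩, h6, h8⟩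
    exact ⟨a, q, ⟨⟨⟨h1, h2.trans h4⟩, h3, h4⟩, h2, h6, h7⟩, h8⟩

theorem pos_of_mem_denoms {m : ℕ} {b : ℤ} {Q q : ℕ} (h : q ∈ denoms m b Q) : 0 < q := by
  simp only [denoms, Finset.mem_filter, Finset.mem_Icc] at h
  exact h.1.1

theorem le_of_mem_denoms {m : ℕ} {b : ℤ} {Q q : ℕ} (h : q ∈ denoms m b Q) : q ≤ Q := by
  simp only [denoms, Finset.mem_filter, Finset.mem_Icc] at h
  exact h.1.2

theorem card_fareyMod (m : ℕ) (b : ℤ) (Q : ℕ) :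
    (fareyMod m b Q).card = ∑ q ∈ denoms m b Q, Nat.totient q := by
  have h1 : fareyMod m b Q = ((denoms m b Q).sigma
      fun q => (Finset.Icc 1 q).filter fun a => a.Coprime q).image
        (fun p : (_ : ℕ) × ℕ => (p.2 : ℝ) / p.1) := by
    ext x
    rw [mem_fareyMod]
    simp only [Finset.mem_image, Finset.mem_sigma, Finset.mem_filter, Finset.mem_Icc,
      Sigma.exists]
    constructor
    · rintro ⟨a, q, h1, h2, h3, h4, h5⟩
      exact ⟨q, a, ⟨h3, ⟨h1, h2⟩, h4⟩, h5⟩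
    · rintro ⟨q, a, ⟨h3, ⟨h1, h2⟩, h4⟩, h5⟩
      exact ⟨a, q, h1, h2, h3, h4, h5⟩
  rw [h1, Finset.card_image_of_injOn, Finset.card_sigma]
  · refine Finset.sum_congr rfl fun q hq => ?_
    have h := Nat.filter_coprime_Ico_eq_totient q 1
    rw [← h]
    congr 1
    ext a
    simp only [Finset.mem_filter, Finset.mem_Icc, Finset.mem_Ico, Nat.coprime_comm]
    omega
  · rintro ⟨q, a⟩ hp ⟨q', a'⟩ hp' h
    simp only [Finset.coe_sigma, Set.mem_sigma_iff, Finset.mem_coe, Finset.mem_filter] at hp hp'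
    obtain ⟨rfl, rfl⟩ := eq_of_div_eq_div_of_coprime (pos_of_mem_denoms hp.1)
      (pos_of_mem_denoms hp'.1) hp.2.2 hp'.2.2 h
    rfl

/-- When `L < N / Q`, the close pairs are enumerated by the value of the determinant `Δ`. -/
theorem ncard_close_pairs_eq_sum {m : ℕ} {b : ℤ} {Q N D : ℕ} {L : ℝ} (hN : 0 < N) (hL : 0 < L)
    (hLQ : L * Q < N) (hD : L * Q ^ 2 ≤ D * N) :
    (Set.ncard {p : ℝ × ℝ | p.1 ∈ fareyMod m b Q ∧ p.2 ∈ fareyMod m b Q ∧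
      0 < p.2 - p.1 ∧ p.2 - p.1 ≤ L / (N : ℝ)} : ℝ) =
    ∑ Δ ∈ Finset.Icc 1 D, ∑ q ∈ denoms m b Q,
      ∑ q' ∈ (denoms m b Q).filter (fun q' : ℕ => (Δ : ℝ) * N / (L * q) ≤ q'),
        (pairCount q q' Δ : ℝ) := by
  classical
  have hNR : (0 : ℝ) < N := by exact_mod_cast hN
  set R : Finset ((_ : ℕ) × (_ : ℕ) × (_ : ℕ) × ℕ) :=
    (Finset.Icc 1 D).sigma fun Δ => (denoms m b Q).sigma fun q =>
      ((denoms m b Q).filter (fun q' : ℕ => (Δ : ℝ) * N / (L * q) ≤ q')).sigma fun q' =>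
        (Finset.Icc 1 q).filter fun a =>
          a.Coprime q ∧ q ∣ a * q' + Δ ∧ ((a * q' + Δ) / q).Coprime q' with hR
  have hcard : R.card = ∑ Δ ∈ Finset.Icc 1 D, ∑ q ∈ denoms m b Q,
      ∑ q' ∈ (denoms m b Q).filter (fun q' : ℕ => (Δ : ℝ) * N / (L * q) ≤ q'),
        pairCount q q' Δ := by
    rw [hR]
    simp only [Finset.card_sigma, pairCount]
  -- The data (Δ, q, q', a) determine the second numerator as (aq' + Δ)/q.
  set F : (_ : ℕ) × (_ : ℕ) × (_ : ℕ) × ℕ → ℝ × ℝ := fun t =>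
    ((t.2.2.2 : ℝ) / t.2.1, (((t.2.2.2 * t.2.2.1 + t.1) / t.2.1 : ℕ) : ℝ) / t.2.2.1) with hF
  have hinj : Set.InjOn F R := by
    rintro ⟨Δ, q, q', a⟩ ht ⟨Δ', r, r', c⟩ ht' h
    simp only [hR, Finset.coe_sigma, Set.mem_sigma_iff, Finset.mem_coe, Finset.mem_filter]
      at ht ht'
    obtain ⟨-, hq, ⟨hq', -⟩, -, hc1, hd1, hc2⟩ := ht
    obtain ⟨-, hr, ⟨hr', -⟩, -, hc3, hd2, hc4⟩ := ht'
    simp only [hF, Prod.mk.injEq] at h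
    obtain ⟨rfl, rfl⟩ := eq_of_div_eq_div_of_coprime (pos_of_mem_denoms hq)
      (pos_of_mem_denoms hr) hc1 hc3 h.1
    obtain ⟨h2, rfl⟩ := eq_of_div_eq_div_of_coprime (pos_of_mem_denoms hq')
      (pos_of_mem_denoms hr') hc2 hc4 h.2
    have h3 := Nat.div_mul_cancel hd1
    have h4 := Nat.div_mul_cancel hd2
    rw [h2, h4] at h3
    have : Δ = Δ' := by omega
    rw [this]
  have hset : {p : ℝ × ℝ | p.1 ∈ fareyMod m b Q ∧ p.2 ∈ fareyMod m b Q ∧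
      0 < p.2 - p.1 ∧ p.2 - p.1 ≤ L / (N : ℝ)} = ↑(R.image F) := by
    ext ⟨x, y⟩
    simp only [Set.mem_ofPred_eq, Finset.coe_image, Set.mem_image, Finset.mem_coe]
    constructor
    · rintro ⟨hx, hy, h0, hle⟩
      obtain ⟨a, q, ha1, haq, hq, hc, rfl⟩ := mem_fareyMod.1 hx
      obtain ⟨c, r, hc1, hcr, hr, hc', rfl⟩ := mem_fareyMod.1 hy
      have hq0 : (0 : ℝ) < q := by exact_mod_cast pos_of_mem_denoms hq
      have hr0 : (0 : ℝ) < r := by exact_mod_cast pos_of_mem_denoms hr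
      have hqQ : (q : ℝ) ≤ Q := by exact_mod_cast le_of_mem_denoms hq
      have hrQ : (r : ℝ) ≤ Q := by exact_mod_cast le_of_mem_denoms hr
      have hlt : a * r < c * q := by
        rw [sub_pos, div_lt_div_iff₀ hq0 hr0] at h0
        exact_mod_cast h0
      obtain ⟨Δ, hΔ⟩ := Nat.exists_eq_add_of_lt hlt
      have hΔ' : a * r + (Δ + 1) = q * c := by rw [mul_comm q c, hΔ]; ring
      have hdiff : (c : ℝ) / r - (a : ℝ) / q = ((Δ + 1 : ℕ) : ℝ) / (q * r) := by
        have : (a : ℝ) * r + ((Δ + 1 : ℕ) : ℝ) = q * c := by exact_mod_cast hΔ'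
        field_simp
        linarith
      rw [hdiff, div_le_div_iff₀ (by positivity) hNR] at hle
      refine ⟨⟨Δ + 1, q, r, a⟩, ?_, ?_⟩
      · simp only [hR, Finset.mem_sigma, Finset.mem_filter, Finset.mem_Icc]
        -- The determinant is `Δ + 1` here; it is at most LQ²/N ≤ D since qr ≤ Q².
        have hΔD : Δ + 1 ≤ D := by
          have h1 : ((Δ + 1 : ℕ) : ℝ) * N ≤ D * N := by
            refine hle.trans (le_trans ?_ hD)
            rw [sq]
            gcongr
          exact_mod_cast le_of_mul_le_mul_right h1 hNR
        refine ⟨⟨by omega, hΔD⟩, hq, ⟨hr, ?_⟩, ⟨ha1, haq⟩, hc, ⟨c, hΔ'⟩, ?_⟩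
        · rw [div_le_iff₀ (by positivity)]
          linarith
        · rw [hΔ', Nat.mul_div_cancel_left _ (pos_of_mem_denoms hq)]
          exact hc'
      · simp only [hF]
        rw [hΔ', Nat.mul_div_cancel_left _ (pos_of_mem_denoms hq)]
    · rintro ⟨⟨Δ, q, r, a⟩, ht, hxy⟩
      simp only [hR, Finset.mem_sigma, Finset.mem_filter, Finset.mem_Icc] at ht
      obtain ⟨⟨hΔ0, -⟩, hq, ⟨hr, hle⟩, ⟨ha1, haq⟩, hc, ⟨c, hd⟩, hc'⟩ := ht
      simp only [hF, Prod.mk.injEq] at hxy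
      rw [hd, Nat.mul_div_cancel_left _ (pos_of_mem_denoms hq)] at hxy hc'
      have hqN := pos_of_mem_denoms hq
      have hrN := pos_of_mem_denoms hr
      have hq0 : (0 : ℝ) < q := by exact_mod_cast hqN
      have hr0 : (0 : ℝ) < r := by exact_mod_cast hrN
      have hrQ : (r : ℝ) ≤ Q := by exact_mod_cast le_of_mem_denoms hr
      rw [div_le_iff₀ (by positivity)] at hle
      have hdR : (a : ℝ) * r + Δ = q * c := by exact_mod_cast hd
      have hΔR : (1 : ℝ) ≤ Δ := by exact_mod_cast hΔ0
      have hdiff : (c : ℝ) / r - (a : ℝ) / q = (Δ : ℝ) / (q * r) := by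
        field_simp
        linarith
      have hc1 : 1 ≤ c := by
        rcases Nat.eq_zero_or_pos c with rfl | h
        · omega
        · exact h
      -- If the second fraction exceeded 1, then Δ ≥ q, and the gap condition would give N ≤ Lr ≤
      -- LQ, against `hLQ`. So no upper constraint on `a` beyond `a ≤ q` is needed.
      have hcr : c ≤ r := by
        by_contra hcon
        have h1 : (r : ℝ) + 1 ≤ c := by exact_mod_cast not_le.1 hcon
        have h2 : (a : ℝ) ≤ q := by exact_mod_cast haq
        have h3 : (q : ℝ) ≤ Δ := by nlinarith
        have h4 : (q : ℝ) * N ≤ r * (L * q) := le_trans (by gcongr) hle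
        have h5 : (N : ℝ) ≤ L * r := by
          refine le_of_mul_le_mul_left ?_ hq0
          linarith
        have h6 : L * r ≤ L * Q := by gcongr
        linarith
      rw [← hxy.1, ← hxy.2, hdiff]
      refine ⟨mem_fareyMod.2 ⟨a, q, ha1, haq, hq, hc, rfl⟩,
        mem_fareyMod.2 ⟨c, r, hc1, hcr, hr, hc', rfl⟩, by positivity, ?_⟩
      rw [div_le_div_iff₀ (by positivity) hNR]
      linarith
  rw [hset, Set.ncard_coe_finset, Finset.card_image_of_injOn hinj, hcard]
  push_cast
  rfl

end FareyPair

namespace FareyPair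

/-! ### The kernel log y / y² and the integral of g -/

/-- The function `log y / y²` for `y ≥ 1`, extended by `0`. -/
noncomputable def logKernel (y : ℝ) : ℝ := Real.log (max y 1) / (max y 1) ^ 2

/-- The primitive of `logKernel` vanishing at `0`. -/
noncomputable def logPrim (y : ℝ) : ℝ := ∫ x in (0 : ℝ)..y, logKernel x

theorem continuous_logKernel : Continuous logKernel := by
  have h : ∀ y : ℝ, max y 1 ≠ 0 := fun y => by positivity
  unfold logKernel
  fun_prop (disch := intro; positivity)

theorem logKernel_of_le_one {y : ℝ} (h : y ≤ 1) : logKernel y = 0 := by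
  simp [logKernel, max_eq_right h]

theorem logKernel_nonneg (y : ℝ) : 0 ≤ logKernel y :=
  div_nonneg (Real.log_nonneg (le_max_right _ _)) (by positivity)

theorem logKernel_le_one (y : ℝ) : logKernel y ≤ 1 := by
  have h1 : 1 ≤ max y 1 := le_max_right _ _
  have h2 := Real.log_le_sub_one_of_pos (by positivity : 0 < max y 1)
  rw [logKernel, div_le_one (by positivity)]
  nlinarith

/-- The kernel takes values in [0, 1]. This Lipschitz bound absorbs the error in N ~ AQ²/2 inside
the argument. -/
theorem abs_logPrim_sub_le (y z : ℝ) : |logPrim y - logPrim z| ≤ |y - z| := by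
  rw [logPrim, logPrim, intervalIntegral.integral_interval_sub_left
    (continuous_logKernel.intervalIntegrable _ _) (continuous_logKernel.intervalIntegrable _ _)]
  have := intervalIntegral.norm_integral_le_of_norm_le_const (a := z) (b := y) (C := 1)
    (f := logKernel) fun x _ => by
      rw [Real.norm_of_nonneg (logKernel_nonneg x)]; exact logKernel_le_one x
  simpa using this

theorem logPrim_of_le_one {y : ℝ} (h : y ≤ 1) : logPrim y = 0 := by
  rw [logPrim, intervalIntegral.integral_zero_ae]
  refine Eventually.of_forall fun x hx => logKernel_of_le_one ?_
  rcases Set.mem_uIoc.1 hx with h' | h'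
  · exact h'.2.trans h
  · exact h'.2.trans zero_le_one

theorem logPrim_of_one_le {y : ℝ} (h : 1 ≤ y) : logPrim y = 1 - 1 / y - Real.log y / y := by
  have h1 := logPrim_of_le_one le_rfl
  rw [logPrim] at h1
  rw [logPrim, ← intervalIntegral.integral_add_adjacent_intervals (b := 1)
    (continuous_logKernel.intervalIntegrable _ _) (continuous_logKernel.intervalIntegrable _ _),
    h1, zero_add]
  have hd : ∀ x ∈ Set.uIcc 1 y, HasDerivAt (fun x => 1 - 1 / x - Real.log x / x)
      (logKernel x) x := by
    intro x hx
    rw [Set.uIcc_of_le h] at hx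
    have hx0 : x ≠ 0 := by linarith [hx.1]
    have h2 := ((hasDerivAt_const x (1 : ℝ)).sub ((hasDerivAt_const x (1 : ℝ)).div
      (hasDerivAt_id x) hx0)).sub ((Real.hasDerivAt_log hx0).div (hasDerivAt_id x) hx0)
    refine HasDerivAt.congr_deriv (f := fun x => 1 - 1 / x - Real.log x / x) h2 ?_
    rw [logKernel, max_eq_left hx.1]
    simp only [id]
    field_simp
    ring
  rw [intervalIntegral.integral_eq_sub_of_hasDerivAt hd
    (continuous_logKernel.intervalIntegrable _ _)]
  simp

theorem abs_logPrim_le_one (y : ℝ) : |logPrim y| ≤ 1 := by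
  rcases le_total y 1 with h | h
  · simp [logPrim_of_le_one h]
  · have h0 : 0 < y := by linarith
    have h1 := Real.log_nonneg h
    have h2 := Real.log_le_sub_one_of_pos h0
    rw [logPrim_of_one_le h, sub_sub, ← add_div]
    have h3 : 0 ≤ (1 + Real.log y) / y := by positivity
    have h4 : (1 + Real.log y) / y ≤ 1 := by rw [div_le_one h0]; linarith
    rw [abs_le]; constructor <;> linarith

/-- The length of the admissible range of the second denominator, as a function of the first. -/
noncomputable def rangeLength (Q T t : ℝ) : ℝ := Q * (1 - T / max t T)

/-- The truncation `max t T` continues Q(1 - T/t) by 0 to the left of T, which gives the monotone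
nonnegative function that partial summation requires. -/
theorem monotone_rangeLength {Q T : ℝ} (hQ : 0 ≤ Q) (hT : 0 < T) :
    Monotone (rangeLength Q T) := by
  intro s t h
  have : 0 < max s T := lt_max_of_lt_right hT
  unfold rangeLength
  gcongr

theorem rangeLength_nonneg {Q T : ℝ} (hQ : 0 ≤ Q) (hT : 0 < T) (t : ℝ) :
    0 ≤ rangeLength Q T t := by
  have h1 : 0 < max t T := lt_max_of_lt_right hT
  refine mul_nonneg hQ (sub_nonneg.2 ?_)
  rw [div_le_one h1]
  exact le_max_right _ _

theorem rangeLength_le {Q T : ℝ} (hQ : 0 ≤ Q) (hT : 0 < T) (t : ℝ) :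
    rangeLength Q T t ≤ Q := by
  have h1 : 0 < max t T := lt_max_of_lt_right hT
  have h2 : 0 ≤ T / max t T := by positivity
  unfold rangeLength
  nlinarith

theorem integral_rangeLength {Q T : ℝ} (hQ : 0 ≤ Q) (hT : 0 < T) :
    ∫ t in (0 : ℝ)..Q, rangeLength Q T t = Q ^ 2 * logPrim (Q / T) := by
  have hz : ∀ S, 0 ≤ S → S ≤ T → ∫ t in (0 : ℝ)..S, rangeLength Q T t = 0 := by
    intro S hS hST
    rw [intervalIntegral.integral_zero_ae]
    refine Eventually.of_forall fun x hx => ?_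
    rw [Set.uIoc_of_le hS] at hx
    rw [rangeLength, max_eq_right (hx.2.trans hST), div_self hT.ne', sub_self, mul_zero]
  rcases le_total Q T with h | h
  · rw [logPrim_of_le_one (by rwa [div_le_one hT]), mul_zero, hz Q hQ h]
  · have hQ0 : 0 < Q := hT.trans_le h
    have hint : ∀ a c, IntervalIntegrable (rangeLength Q T) volume a c := fun a c =>
      (monotone_rangeLength hQ hT).intervalIntegrable
    rw [← intervalIntegral.integral_add_adjacent_intervals (hint 0 T) (hint T Q),
      hz T hT.le le_rfl, zero_add, logPrim_of_one_le (by rwa [one_le_div hT])]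
    have hd : ∀ x ∈ Set.uIcc T Q, HasDerivAt (fun x => Q * (x - T * Real.log x))
        (rangeLength Q T x) x := by
      intro x hx
      rw [Set.uIcc_of_le h] at hx
      have hx0 : x ≠ 0 := by linarith [hx.1]
      refine HasDerivAt.congr_deriv (f := fun x => Q * (x - T * Real.log x))
        (((hasDerivAt_id x).sub ((Real.hasDerivAt_log hx0).const_mul T)).const_mul Q) ?_
      rw [rangeLength, max_eq_left hx.1, div_eq_mul_inv]
    rw [intervalIntegral.integral_eq_sub_of_hasDerivAt hd (hint T Q),
      Real.log_div hQ0.ne' hT.ne']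
    field_simp
    ring

theorem constC_eq {m : ℕ} (hm : 0 < m) : constC m = Nat.totient m * weightDensity m := by
  have h1 : (0 : ℝ) < Nat.totient m := by exact_mod_cast Nat.totient_pos.2 hm
  rw [weightDensity]; field_simp

theorem pairWeight_eq {m Δ : ℕ} (hm : 0 < m) (hΔ : 0 < Δ) :
    (Nat.totient Δ : ℝ) * ((Nat.gcd Δ m : ℝ) / Nat.totient (Nat.gcd Δ m)) =
      Δ * pairWeight m Δ := by
  have h1 : (0 : ℝ) < Δ := by exact_mod_cast hΔ
  rw [pairWeight, sum_divisors_moebius_invCoprime hm.ne' hΔ.ne']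
  field_simp

theorem pairWeight_nonneg {m Δ : ℕ} (hm : 0 < m) (hΔ : 0 < Δ) : 0 ≤ pairWeight m Δ := by
  rw [pairWeight, sum_divisors_moebius_invCoprime hm.ne' hΔ.ne']
  positivity

theorem abs_pairWeight_le (m Δ : ℕ) : |pairWeight m Δ| ≤ Δ := by
  have h : (Δ.divisors.card : ℝ) ≤ Δ := by exact_mod_cast Nat.card_divisors_le_self Δ
  refine (Finset.abs_sum_le_sum_abs _ _).trans
    ((Finset.sum_le_card_nsmul _ _ 1 fun e he => ?_).trans ?_)
  · rw [abs_mul]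
    have he : (1 : ℝ) ≤ e := by exact_mod_cast Nat.pos_of_mem_divisors he
    have h2 := (abs_invCoprime_le m e).trans (inv_le_one_of_one_le₀ he)
    calc _ ≤ (1 : ℝ) * 1 :=
          mul_le_mul (abs_moebius_cast_le e) h2 (abs_nonneg _) zero_le_one
      _ = 1 := one_mul _
  · rw [nsmul_eq_mul, mul_one]; exact h

/-- Since C_m = φ(m)A, the dilation by φ(m) cancels. Terms with Δ > 2x/A vanish because the kernel
is 0 below 1, so the range of summation no longer depends on x; at x = 0 both sides are 0.
Continuity and termwise integration follow. -/
theorem gCoprime_totient_mul_eq {m : ℕ} (hm : 0 < m) {D : ℕ} {x : ℝ} (hx : 0 ≤ x)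
    (hD : 2 * x / weightDensity m ≤ D) :
    gCoprime m (Nat.totient m * x) = ∑ Δ ∈ Finset.Icc 1 D, 2 / m * pairWeight m Δ *
      (2 / (weightDensity m * Δ) * logKernel (2 / (weightDensity m * Δ) * x)) := by
  have hφ : (0 : ℝ) < Nat.totient m := by exact_mod_cast Nat.totient_pos.2 hm
  have hmR : (0 : ℝ) < m := by exact_mod_cast hm
  set A := weightDensity m with hAdef
  have hA : 0 < A := weightDensity_pos hm
  rw [gCoprime, constC_eq hm, ← hAdef,
    show 2 * ((Nat.totient m : ℝ) * x) / (Nat.totient m * A) = 2 * x / A by field_simp]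
  have hfl : ⌊2 * x / A⌋₊ ≤ D := Nat.floor_le_of_le hD
  rw [← Finset.sum_subset (Finset.Icc_subset_Icc_right hfl)]
  · rw [Finset.mul_sum]
    refine Finset.sum_congr rfl fun Δ hΔ => ?_
    rw [Finset.mem_Icc] at hΔ
    have hΔR : (0 : ℝ) < Δ := by exact_mod_cast hΔ.1
    have hle : (Δ : ℝ) ≤ 2 * x / A := (Nat.le_floor_iff (by positivity)).1 hΔ.2
    have hx0 : 0 < x := by
      rw [le_div_iff₀ hA] at hle
      nlinarith [mul_pos hΔR hA]
    have hy : 1 ≤ 2 / (A * Δ) * x := by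
      rw [le_div_iff₀ hA] at hle
      rw [div_mul_eq_mul_div, one_le_div (by positivity)]
      linarith
    rw [pairWeight_eq hm hΔ.1, logKernel, max_eq_left hy,
      show 2 * ((Nat.totient m : ℝ) * x) / (Nat.totient m * A * Δ) = 2 / (A * Δ) * x by
        field_simp]
    field_simp
  · intro Δ hΔ hΔ'
    rw [Finset.mem_Icc] at hΔ hΔ'
    have hΔR : (0 : ℝ) < Δ := by exact_mod_cast hΔ.1
    have hlt : 2 * x / A < Δ := by
      have : ⌊2 * x / A⌋₊ < Δ := by
        by_contra h; exact hΔ' ⟨hΔ.1, not_lt.1 h⟩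
      exact (Nat.floor_lt (by positivity)).1 this
    rw [logKernel_of_le_one]
    · ring
    · rw [div_lt_iff₀ hA] at hlt
      rw [div_mul_eq_mul_div, div_le_one (by positivity)]
      linarith

theorem integral_gCoprime {m : ℕ} (hm : 0 < m) {D : ℕ} {L : ℝ} (hL : 0 ≤ L)
    (hD : 2 * L / weightDensity m ≤ D) :
    ∫ x in (0 : ℝ)..L, gCoprime m (Nat.totient m * x) =
      2 / m * ∑ Δ ∈ Finset.Icc 1 D, pairWeight m Δ * logPrim (2 * L / (weightDensity m * Δ)) := by
  have hA : 0 < weightDensity m := weightDensity_pos hm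
  have h1 : ∫ x in (0 : ℝ)..L, gCoprime m (Nat.totient m * x) =
      ∫ x in (0 : ℝ)..L, ∑ Δ ∈ Finset.Icc 1 D, 2 / m * pairWeight m Δ *
      (2 / (weightDensity m * Δ) * logKernel (2 / (weightDensity m * Δ) * x)) := by
    refine intervalIntegral.integral_congr fun x hx => ?_
    rw [Set.uIcc_of_le hL] at hx
    refine gCoprime_totient_mul_eq hm hx.1 (le_trans ?_ hD)
    have := hx.2
    gcongr
  rw [h1, intervalIntegral.integral_finsetSum, Finset.mul_sum]
  · refine Finset.sum_congr rfl fun Δ hΔ => ?_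
    rw [intervalIntegral.integral_const_mul, intervalIntegral.integral_const_mul,
      intervalIntegral.mul_integral_comp_mul_left, mul_zero, mul_assoc,
      div_mul_eq_mul_div 2 (weightDensity m * (Δ : ℝ)) L]
    rfl
  · intro Δ _
    apply Continuous.intervalIntegrable
    have := continuous_logKernel
    fun_prop

theorem continuousOn_gCoprime {m : ℕ} (hm : 0 < m) :
    ContinuousOn (fun x => gCoprime m (Nat.totient m * x)) (Set.Ici 0) := by
  intro x hx
  -- One `D` serves all points up to `x + 1`, a neighbourhood of `x`.
  set D := ⌈2 * (x + 1) / weightDensity m⌉₊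
  have hA : 0 < weightDensity m := weightDensity_pos hm
  have hc : Continuous fun x => ∑ Δ ∈ Finset.Icc 1 D, 2 / m * pairWeight m Δ *
      (2 / (weightDensity m * Δ) * logKernel (2 / (weightDensity m * Δ) * x)) := by
    have := continuous_logKernel
    fun_prop
  refine (hc.continuousWithinAt (s := Set.Ici 0) (x := x)).congr_of_eventuallyEq ?_ ?_
  · have : Set.Iio (x + 1) ∈ 𝓝[Set.Ici 0] x :=
      mem_nhdsWithin_of_mem_nhds (Iio_mem_nhds (by linarith))
    filter_upwards [this, self_mem_nhdsWithin] with y hy hy0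
    refine gCoprime_totient_mul_eq hm hy0 (le_trans ?_ (Nat.le_ceil _))
    have : y ≤ x + 1 := le_of_lt hy
    gcongr
  · refine gCoprime_totient_mul_eq hm hx (le_trans ?_ (Nat.le_ceil _))
    gcongr
    linarith

theorem gCoprime_nonneg {m : ℕ} (hm : 0 < m) {x : ℝ} (hx : 0 ≤ x) :
    0 ≤ gCoprime m (Nat.totient m * x) := by
  have hA : 0 < weightDensity m := weightDensity_pos hm
  rw [gCoprime_totient_mul_eq hm hx (Nat.le_ceil _)]
  refine Finset.sum_nonneg fun Δ hΔ => ?_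
  have h1 := pairWeight_nonneg hm (Finset.mem_Icc.1 hΔ).1
  have h2 := logKernel_nonneg (2 / (weightDensity m * Δ) * x)
  positivity

/-! ### Asymptotics for the number of close pairs -/

/-- The lower end point ΔN/(Lq) is at most Q exactly when q ≥ T = ΔN/(LQ). For smaller q there is no
q', and the truncated length is 0 as well. -/
theorem abs_sum_pairCount_sub_rangeLength_le {m : ℕ} (hm : 0 < m) {b : ℤ}
    (hb : IsCoprime b (m : ℤ)) {Q N : ℕ} (hQ : 0 < Q) (hN : 0 < N) {q Δ : ℕ}
    (hq : q ∈ denoms m b Q) (hΔ : 0 < Δ) {L : ℝ} (hL : 0 < L) :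
    |∑ q' ∈ (denoms m b Q).filter (fun q' : ℕ => (Δ : ℝ) * N / (L * q) ≤ q'),
        (pairCount q q' Δ : ℝ) -
      pairWeight m Δ / m * ((Nat.totient q : ℝ) / q * rangeLength Q (Δ * N / (L * Q)) q)| ≤
      12 * Δ ^ 2 * √Q := by
  have hq0 := pos_of_mem_denoms hq
  have hqR : (0 : ℝ) < q := by exact_mod_cast hq0
  have hQR : (0 : ℝ) < Q := by exact_mod_cast hQ
  have hNR : (0 : ℝ) < N := by exact_mod_cast hN
  have hΔR : (0 : ℝ) < Δ := by exact_mod_cast hΔ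
  have hmR : (0 : ℝ) < m := by exact_mod_cast hm
  have hqQ : (q : ℝ) ≤ Q := by exact_mod_cast le_of_mem_denoms hq
  have hα : 0 < (Δ : ℝ) * N / (L * q) := by positivity
  have hT : 0 < (Δ : ℝ) * N / (L * Q) := by positivity
  rcases le_or_gt ((Δ : ℝ) * N / (L * q)) Q with h | h
  · have key := abs_sum_pairCount_sub_le hm hb hq0 (coprime_of_mem_denoms hb hq) hΔ hα h
    have hTq : (Δ : ℝ) * N / (L * Q) ≤ q := by
      rw [div_le_iff₀ (by positivity)] at h ⊢
      linarith
    have e : pairWeight m Δ / m *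
        ((Nat.totient q : ℝ) / q * rangeLength Q (Δ * N / (L * Q)) q) =
        pairWeight m Δ * ((Q - (Δ : ℝ) * N / (L * q)) / m * ((Nat.totient q : ℝ) / q)) := by
      rw [rangeLength, max_eq_left hTq]
      field_simp
    rw [e]
    refine key.trans ?_
    gcongr
  · have hTq : (q : ℝ) ≤ (Δ : ℝ) * N / (L * Q) := by
      rw [lt_div_iff₀ (by positivity)] at h
      rw [le_div_iff₀ (by positivity)]
      linarith
    have hempty : (denoms m b Q).filter (fun q' : ℕ => (Δ : ℝ) * N / (L * q) ≤ q') = ∅ := by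
      refine Finset.filter_eq_empty_iff.2 fun q' hq' hle => ?_
      have : (q' : ℝ) ≤ Q := by exact_mod_cast le_of_mem_denoms hq'
      linarith
    rw [hempty, rangeLength, max_eq_right hTq, div_self hT.ne']
    simp only [Finset.sum_empty, sub_self, mul_zero, abs_zero]
    positivity

theorem abs_sum_sum_pairCount_sub_le {m : ℕ} (hm : 0 < m) {b : ℤ}
    (hb : IsCoprime b (m : ℤ)) {Q N : ℕ} (hQ : 0 < Q) (hN : 0 < N) {Δ : ℕ} (hΔ : 0 < Δ) {L : ℝ}
    (hL : 0 < L) :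
    |∑ q ∈ denoms m b Q,
      ∑ q' ∈ (denoms m b Q).filter (fun q' : ℕ => (Δ : ℝ) * N / (L * q) ≤ q'),
        (pairCount q q' Δ : ℝ) -
      weightDensity m / m * Q ^ 2 * (pairWeight m Δ * logPrim (L * Q ^ 2 / (Δ * N)))| ≤
      (12 * Δ ^ 2 + Δ * (16 + weightDensity m)) * (Q * √Q) := by
  have hQR : (1 : ℝ) ≤ Q := by exact_mod_cast hQ
  have hNR : (0 : ℝ) < N := by exact_mod_cast hN
  have hΔR : (0 : ℝ) < Δ := by exact_mod_cast hΔ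
  have hmR : (1 : ℝ) ≤ m := by exact_mod_cast hm
  have hA := weightDensity_pos hm
  set A := weightDensity m
  set T : ℝ := (Δ : ℝ) * N / (L * Q) with hTdef
  have hT : 0 < T := by positivity
  have h1 : |∑ q ∈ denoms m b Q,
      ∑ q' ∈ (denoms m b Q).filter (fun q' : ℕ => (Δ : ℝ) * N / (L * q) ≤ q'),
        (pairCount q q' Δ : ℝ) - pairWeight m Δ / m *
        ∑ q ∈ denoms m b Q, (Nat.totient q : ℝ) / q * rangeLength Q T q| ≤
        Q * (12 * Δ ^ 2 * √Q) := by
    rw [Finset.mul_sum, ← Finset.sum_sub_distrib]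
    refine (Finset.abs_sum_le_sum_abs _ _).trans ((Finset.sum_le_card_nsmul _ _ _ fun q hq =>
      abs_sum_pairCount_sub_rangeLength_le hm hb hQ hN hq hΔ hL).trans ?_)
    rw [nsmul_eq_mul]
    have : ((denoms m b Q).card : ℝ) ≤ Q := by
      have := Finset.card_filter_le (Finset.Icc 1 Q) (fun q : ℕ => (q : ℤ) ≡ b [ZMOD m])
      rw [Nat.card_Icc] at this
      exact_mod_cast this
    gcongr
  have h2 := abs_sum_totient_div_mul_sub_le hm hb
    (monotone_rangeLength (Q := Q) (by linarith) hT)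
    (rangeLength_nonneg (Q := Q) (by linarith) hT) Q
  rw [integral_rangeLength (by linarith) hT] at h2
  have hQT : (Q : ℝ) / T = L * Q ^ 2 / (Δ * N) := by
    rw [hTdef]; field_simp
  rw [hQT] at h2
  have hs : 1 ≤ √(Q : ℝ) := by rw [Real.one_le_sqrt]; exact hQR
  have h3 : (16 * √(Q : ℝ) + A) * rangeLength Q T Q ≤ (16 + A) * (Q * √Q) := by
    have h4 := rangeLength_le (Q := Q) (by linarith) hT Q
    calc _ ≤ (16 * √(Q : ℝ) + A) * Q := by gcongr
      _ ≤ (16 * √(Q : ℝ) + A * √(Q : ℝ)) * Q := by gcongr; nlinarith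
      _ = _ := by ring
  have h5 : |pairWeight m Δ / m * ∑ q ∈ denoms m b Q, (Nat.totient q : ℝ) / q *
      rangeLength Q T q - A / m * Q ^ 2 * (pairWeight m Δ * logPrim (L * Q ^ 2 / (Δ * N)))| ≤
      Δ * ((16 + A) * (Q * √Q)) := by
    have e : pairWeight m Δ / m * ∑ q ∈ denoms m b Q, (Nat.totient q : ℝ) / q *
      rangeLength Q T q - A / m * Q ^ 2 * (pairWeight m Δ * logPrim (L * Q ^ 2 / (Δ * N))) =
      pairWeight m Δ / m * (∑ q ∈ denoms m b Q, (Nat.totient q : ℝ) / q *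
      rangeLength Q T q - A * (Q ^ 2 * logPrim (L * Q ^ 2 / (Δ * N)))) := by ring
    rw [e, abs_mul, abs_div, Nat.abs_cast]
    have h6 : |pairWeight m Δ| / m ≤ Δ :=
      (div_le_self (abs_nonneg _) hmR).trans (abs_pairWeight_le m Δ)
    exact mul_le_mul h6 (h2.trans h3) (abs_nonneg _) hΔR.le
  have := (abs_sub_le _ _ _).trans (add_le_add h1 h5)
  refine this.trans (le_of_eq (by ring))

/-- The main estimate for the number of close pairs, with `N` any approximation to `A Q² / 2`. -/
theorem abs_ncard_close_pairs_div_sub_le {m : ℕ} (hm : 0 < m) {b : ℤ} (hb : IsCoprime b (m : ℤ))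
    {Q N D : ℕ} (hQ : 0 < Q) {K L : ℝ} (hL : 0 < L) (hLK : L ≤ K)
    (hN4 : weightDensity m * Q ^ 2 / 4 ≤ N)
    (hNA : |(N : ℝ) - weightDensity m * Q ^ 2 / 2| ≤ (16 + weightDensity m) * (Q * √Q))
    (hLQ : L * Q < N) (hD : 4 * K / weightDensity m ≤ D) :
    |1 / (N : ℝ) * (Set.ncard {p : ℝ × ℝ | p.1 ∈ fareyMod m b Q ∧ p.2 ∈ fareyMod m b Q ∧
      0 < p.2 - p.1 ∧ p.2 - p.1 ≤ L / (N : ℝ)} : ℝ) -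
      ∫ x in (0 : ℝ)..L, gCoprime m (Nat.totient m * x)| ≤
      (4 * (D * (12 * D ^ 2 + D * (16 + weightDensity m))) / weightDensity m +
        (1 + 2 * K / weightDensity m) * D ^ 2 * (8 * (16 + weightDensity m) / weightDensity m)) *
        (√Q)⁻¹ := by
  have hQR : (1 : ℝ) ≤ Q := by exact_mod_cast hQ
  have hmR : (1 : ℝ) ≤ m := by exact_mod_cast hm
  have hA := weightDensity_pos hm
  set A := weightDensity m with hAdef
  have hNR : (0 : ℝ) < N := lt_of_lt_of_le (by positivity) hN4
  have hN : 0 < N := by exact_mod_cast hNR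
  have hs : 0 < √(Q : ℝ) := Real.sqrt_pos.2 (by linarith)
  have hss : √(Q : ℝ) * √Q = Q := Real.mul_self_sqrt (by linarith)
  -- Errors of order Q^(3/2) become Q^(-1/2) after division by N ≥ AQ²/4.
  have hdivN : (Q * √Q : ℝ) / N ≤ 4 / A * (√Q)⁻¹ := by
    rw [div_le_iff₀ hNR]
    calc (Q * √Q : ℝ) = 4 / A * (√Q)⁻¹ * (A * Q ^ 2 / 4) := by
          field_simp; nlinarith
      _ ≤ _ := by gcongr
  have hKD : 4 * K ≤ D * A := by rwa [div_le_iff₀ hA] at hD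
  have hDN : L * Q ^ 2 ≤ D * N := by
    calc L * (Q : ℝ) ^ 2 ≤ K * Q ^ 2 := by gcongr
      _ ≤ D * A / 4 * Q ^ 2 := by gcongr; linarith
      _ = D * (A * Q ^ 2 / 4) := by ring
      _ ≤ D * N := by gcongr
  have hDL : 2 * L / A ≤ D := by
    rw [div_le_iff₀ hA]; linarith
  rw [ncard_close_pairs_eq_sum hN hL hLQ hDN, integral_gCoprime hm hL.le hDL, ← hAdef]
  set ρ : ℝ := Q ^ 2 / N with hρ
  set P : ℝ := ∑ Δ ∈ Finset.Icc 1 D, ∑ q ∈ denoms m b Q,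
      ∑ q' ∈ (denoms m b Q).filter (fun q' : ℕ => (Δ : ℝ) * N / (L * q) ≤ q'),
        (pairCount q q' Δ : ℝ) with hP
  have hD0 : (0 : ℝ) ≤ D := Nat.cast_nonneg D
  have h1 : |P - A / m * Q ^ 2 *
      ∑ Δ ∈ Finset.Icc 1 D, pairWeight m Δ * logPrim (L * Q ^ 2 / (Δ * N))| ≤
      D * ((12 * D ^ 2 + D * (16 + A)) * (Q * √Q)) := by
    rw [hP, Finset.mul_sum, ← Finset.sum_sub_distrib]
    refine (Finset.abs_sum_le_sum_abs _ _).trans ((Finset.sum_le_card_nsmul _ _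
      ((12 * (D : ℝ) ^ 2 + D * (16 + A)) * (Q * √Q)) fun Δ hΔ => ?_).trans ?_)
    · rw [Finset.mem_Icc] at hΔ
      refine (abs_sum_sum_pairCount_sub_le hm hb hQ hN hΔ.1 hL).trans ?_
      have : (Δ : ℝ) ≤ D := by exact_mod_cast hΔ.2
      gcongr
    · rw [nsmul_eq_mul, Nat.card_Icc, Nat.add_sub_cancel]
  have h2 : |1 / (N : ℝ) * P - A * ρ / m *
      ∑ Δ ∈ Finset.Icc 1 D, pairWeight m Δ * logPrim (L * Q ^ 2 / (Δ * N))| ≤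
      4 * (D * (12 * D ^ 2 + D * (16 + A))) / A * (√Q)⁻¹ := by
    have e : 1 / (N : ℝ) * P - A * ρ / m *
      ∑ Δ ∈ Finset.Icc 1 D, pairWeight m Δ * logPrim (L * Q ^ 2 / (Δ * N)) =
      (P - A / m * Q ^ 2 *
      ∑ Δ ∈ Finset.Icc 1 D, pairWeight m Δ * logPrim (L * Q ^ 2 / (Δ * N))) / N := by
      rw [hρ]; field_simp
    rw [e, abs_div, Nat.abs_cast]
    calc _ ≤ D * ((12 * D ^ 2 + D * (16 + A)) * (Q * √Q)) / N := by gcongr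
      _ = D * (12 * D ^ 2 + D * (16 + A)) * (Q * √Q / N) := by ring
      _ ≤ D * (12 * D ^ 2 + D * (16 + A)) * (4 / A * (√Q)⁻¹) := by gcongr
      _ = _ := by ring
  -- AQ²/N tends to 2. This ratio enters twice below: as a factor, and inside `logPrim`.
  have hη : |A * ρ - 2| ≤ 8 * (16 + A) / A * (√Q)⁻¹ := by
    have e : A * ρ - 2 = -2 * ((N : ℝ) - A * Q ^ 2 / 2) / N := by
      rw [hρ]; field_simp; ring
    rw [e, abs_div, abs_mul, Nat.abs_cast, show |(-2 : ℝ)| = 2 by norm_num]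
    calc _ ≤ 2 * ((16 + A) * (Q * √Q)) / N := by gcongr
      _ = 2 * (16 + A) * (Q * √Q / N) := by ring
      _ ≤ 2 * (16 + A) * (4 / A * (√Q)⁻¹) := by gcongr
      _ = _ := by ring
  set η : ℝ := 8 * (16 + A) / A * (√Q)⁻¹ with hηdef
  have hη0 : 0 ≤ η := by positivity
  have h3 : |A * ρ / m * ∑ Δ ∈ Finset.Icc 1 D, pairWeight m Δ * logPrim (L * Q ^ 2 / (Δ * N)) -
      2 / m * ∑ Δ ∈ Finset.Icc 1 D, pairWeight m Δ * logPrim (2 * L / (A * Δ))| ≤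
      D * (D * ((1 + 2 * K / A) * η)) := by
    rw [Finset.mul_sum, Finset.mul_sum, ← Finset.sum_sub_distrib]
    refine (Finset.abs_sum_le_sum_abs _ _).trans ((Finset.sum_le_card_nsmul _ _
      (D * ((1 + 2 * K / A) * η)) fun Δ hΔ => ?_).trans ?_)
    · rw [Finset.mem_Icc] at hΔ
      have hΔ1 : (1 : ℝ) ≤ Δ := by exact_mod_cast hΔ.1
      have hΔD : (Δ : ℝ) ≤ D := by exact_mod_cast hΔ.2
      set k₁ := logPrim (L * Q ^ 2 / (Δ * N))
      set k₂ := logPrim (2 * L / (A * Δ))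
      have hk : |k₁ - k₂| ≤ K / A * η := by
        refine (abs_logPrim_sub_le _ _).trans ?_
        have e : L * Q ^ 2 / (Δ * N) - 2 * L / (A * Δ) = L / (A * Δ) * (A * ρ - 2) := by
          rw [hρ]; field_simp
        rw [e, abs_mul, abs_of_nonneg (by positivity : 0 ≤ L / (A * Δ))]
        have : L / (A * Δ) ≤ K / A := by
          apply div_le_div₀ (hL.le.trans hLK) hLK hA
          nlinarith
        exact mul_le_mul this hη (abs_nonneg _) (div_nonneg (hL.le.trans hLK) hA.le)
      have hk1 : |k₁| ≤ 1 := abs_logPrim_le_one _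
      have e : A * ρ / m * (pairWeight m Δ * k₁) - 2 / m * (pairWeight m Δ * k₂) =
          pairWeight m Δ / m * ((A * ρ - 2) * k₁ + 2 * (k₁ - k₂)) := by ring
      rw [e, abs_mul, abs_div, Nat.abs_cast]
      have h6 : |pairWeight m Δ| / m ≤ D :=
        ((div_le_self (abs_nonneg _) hmR).trans (abs_pairWeight_le m Δ)).trans hΔD
      refine mul_le_mul h6 ?_ (abs_nonneg _) hD0
      refine (abs_add_le _ _).trans ?_
      rw [abs_mul, abs_mul, abs_two]
      have := mul_le_mul hη hk1 (abs_nonneg _) hη0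
      have e2 : (1 + 2 * K / A) * η = η * 1 + 2 * (K / A * η) := by ring
      rw [e2]
      linarith
    · rw [nsmul_eq_mul, Nat.card_Icc, Nat.add_sub_cancel]
  have := (abs_sub_le _ _ _).trans (add_le_add h2 h3)
  refine this.trans (le_of_eq ?_)
  rw [hηdef]; ring

/-! ### Both correlation counts, uniformly in Q and b -/

theorem inv_le_of_mem_fareyMod {m : ℕ} {b : ℤ} {Q : ℕ} {x : ℝ} (h : x ∈ fareyMod m b Q) :
    1 / (Q : ℝ) ≤ x ∧ x ≤ 1 := by
  obtain ⟨a, q, h1, h2, h3, -, rfl⟩ := mem_fareyMod.1 h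
  have hq : (0 : ℝ) < q := by exact_mod_cast pos_of_mem_denoms h3
  have hqQ : (q : ℝ) ≤ Q := by exact_mod_cast le_of_mem_denoms h3
  have h1' : (1 : ℝ) ≤ a := by exact_mod_cast h1
  have h2' : (a : ℝ) ≤ q := by exact_mod_cast h2
  exact ⟨div_le_div₀ (by linarith) h1' hq hqQ, (div_le_one hq).2 h2'⟩

/-- The fractions lie in [1/Q, 1], so differences are at most 1 - 1/Q in absolute value. Since L/N <
1/Q, only the translate by k = 0 can occur. -/
theorem pairCorr_Icc_eq_cumulCorr {m : ℕ} {b : ℤ} {Q : ℕ} {L : ℝ} (hL : 0 ≤ L)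
    (hLQ : L * Q < (fareyMod m b Q).card) :
    pairCorr (fareyMod m b Q) (Set.Icc 0 L) = cumulCorr (fareyMod m b Q) L := by
  set N := (fareyMod m b Q).card with hN
  have hNR : (0 : ℝ) < N := lt_of_le_of_lt (by positivity) hLQ
  rw [pairCorr, cumulCorr]
  congr 3
  ext ⟨x, y⟩
  simp only [Set.mem_ofPred_eq]
  refine and_congr_right fun hx => and_congr_right fun hy => ?_
  obtain ⟨hx1, hx2⟩ := inv_le_of_mem_fareyMod hx
  obtain ⟨hy1, hy2⟩ := inv_le_of_mem_fareyMod hy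
  have hQ : (0 : ℝ) < Q := by
    obtain ⟨a, q, -, -, h3, -⟩ := mem_fareyMod.1 hx
    exact_mod_cast (pos_of_mem_denoms h3).trans_le (le_of_mem_denoms h3)
  have hQ' : (0 : ℝ) < 1 / Q := by positivity
  rw [← hN]
  constructor
  · rintro ⟨hne, t, ht, k, hk⟩
    have ht0 : 0 ≤ t / N := div_nonneg ht.1 hNR.le
    have htL : t / N ≤ L / N := div_le_div_of_nonneg_right ht.2 hNR.le
    have hlt : L / N < 1 / Q := by rw [div_lt_div_iff₀ hNR hQ]; linarith
    have hk0 : k = 0 := by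
      have h1 : (k : ℝ) < 1 := by linarith
      have h2 : (-1 : ℝ) < k := by linarith
      have h1' : k < 1 := by exact_mod_cast h1
      have h2' : -1 < k := by exact_mod_cast h2
      omega
    rw [hk0, Int.cast_zero, add_zero] at hk
    exact ⟨lt_of_le_of_ne (hk ▸ ht0) fun h => hne (by linarith), hk ▸ htL⟩
  · rintro ⟨h0, hle⟩
    refine ⟨fun h => by simp [h] at h0, (y - x) * N, ⟨by positivity, ?_⟩, 0, ?_⟩
    · rwa [le_div_iff₀ hNR] at hle
    · rw [Int.cast_zero, add_zero]; field_simp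

theorem one_div_card_mul_ncard_le (F : Finset ℝ) {S : Set (ℝ × ℝ)}
    (hS : S ⊆ ↑(F ×ˢ F)) : 1 / (F.card : ℝ) * (Set.ncard S : ℝ) ≤ F.card := by
  have h1 : Set.ncard S ≤ F.card * F.card := by
    have := Set.ncard_le_ncard hS (Finset.finite_toSet _)
    rwa [Set.ncard_coe_finset, Finset.card_product] at this
  have h2 : (Set.ncard S : ℝ) ≤ F.card * F.card := by exact_mod_cast h1
  rcases Nat.eq_zero_or_pos F.card with h | h
  · simp [h]
  · have h' : (0 : ℝ) < F.card := by exact_mod_cast h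
    rw [one_div, inv_mul_le_iff₀ h']
    exact h2

theorem pairCorr_nonneg (F : Finset ℝ) (I : Set ℝ) : 0 ≤ pairCorr F I := by
  unfold pairCorr; positivity

theorem pairCorr_le_card (F : Finset ℝ) (I : Set ℝ) : pairCorr F I ≤ F.card := by
  refine one_div_card_mul_ncard_le F ?_
  rintro ⟨x, y⟩ h
  simp only [Finset.coe_product, Set.mem_prod, Finset.mem_coe]
  exact ⟨h.1, h.2.1⟩

theorem cumulCorr_nonneg (F : Finset ℝ) (L : ℝ) : 0 ≤ cumulCorr F L := by
  unfold cumulCorr; positivity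

theorem cumulCorr_le_card (F : Finset ℝ) (L : ℝ) : cumulCorr F L ≤ F.card := by
  refine one_div_card_mul_ncard_le F ?_
  rintro ⟨x, y⟩ h
  simp only [Finset.coe_product, Set.mem_prod, Finset.mem_coe]
  exact ⟨h.1, h.2.1⟩

theorem card_fareyMod_le (m : ℕ) (b : ℤ) (Q : ℕ) : (fareyMod m b Q).card ≤ Q ^ 2 := by
  refine Finset.card_image_le.trans ((Finset.card_filter_le _ _).trans ?_)
  simp [sq]

theorem card_fareyMod_asymp {m : ℕ} (hm : 0 < m) (K : ℝ) :
    ∃ Q₀ : ℕ, 1 ≤ Q₀ ∧ ∀ b : ℤ, IsCoprime b (m : ℤ) → ∀ Q : ℕ, Q₀ ≤ Q →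
      weightDensity m * Q ^ 2 / 4 ≤ (fareyMod m b Q).card ∧
      |((fareyMod m b Q).card : ℝ) - weightDensity m * Q ^ 2 / 2| ≤
        (16 + weightDensity m) * (Q * √Q) ∧
      K * Q < (fareyMod m b Q).card := by
  have hA := weightDensity_pos hm
  set A := weightDensity m
  -- The first summand makes the error at most half of AQ²/2; the second gives KQ < AQ²/4. Neither
  -- depends on b.
  refine ⟨⌈(4 * (16 + A) / A) ^ 2⌉₊ + ⌈4 * K / A⌉₊ + 1, by omega, fun b hb Q hQ => ?_⟩
  have hQR : (⌈(4 * (16 + A) / A) ^ 2⌉₊ : ℝ) + ⌈4 * K / A⌉₊ + 1 ≤ Q := by exact_mod_cast hQ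
  have c1 := Nat.le_ceil ((4 * (16 + A) / A) ^ 2)
  have c2 := Nat.le_ceil (4 * K / A)
  have c3 : (0 : ℝ) ≤ ⌈(4 * (16 + A) / A) ^ 2⌉₊ := Nat.cast_nonneg _
  have c4 : (0 : ℝ) ≤ ⌈4 * K / A⌉₊ := Nat.cast_nonneg _
  have hQ1 : (1 : ℝ) ≤ Q := by linarith
  have hs1 : 1 ≤ √(Q : ℝ) := by rw [Real.one_le_sqrt]; exact hQ1
  have hss : √(Q : ℝ) * √Q = Q := Real.mul_self_sqrt (by linarith)
  have hasym : |((fareyMod m b Q).card : ℝ) - A * Q ^ 2 / 2| ≤ (16 + A) * (Q * √Q) := by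
    rw [card_fareyMod]
    push_cast
    refine (abs_sum_totient_sub_le hm hb Q).trans ?_
    calc (16 * √(Q : ℝ) + A) * Q ≤ (16 * √(Q : ℝ) + A * √Q) * Q := by gcongr; nlinarith
      _ = _ := by ring
  have hlow : A * Q ^ 2 / 4 ≤ (fareyMod m b Q).card := by
    have h1 : 4 * (16 + A) / A ≤ √(Q : ℝ) := Real.le_sqrt_of_sq_le (by linarith)
    rw [div_le_iff₀ hA] at h1
    have h2 : (16 + A) * (Q * √Q) ≤ A * Q ^ 2 / 4 := by
      have : (4 * (16 + A)) * (Q * √Q) ≤ (√Q * A) * (Q * √Q) := by gcongr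
      have e : (√(Q : ℝ) * A) * (Q * √Q) = A * Q ^ 2 := by
        calc (√(Q : ℝ) * A) * (Q * √Q) = A * Q * (√Q * √Q) := by ring
          _ = _ := by rw [hss]; ring
      linarith
    have := (abs_le.1 hasym).1
    linarith
  refine ⟨hlow, hasym, lt_of_lt_of_le ?_ hlow⟩
  have h3 : 4 * K / A < Q := by linarith
  rw [div_lt_iff₀ hA] at h3
  nlinarith

/-- Both counting functions of the Farey fractions `a/q`, `q ≡ b (mod m)`, approach the integral
of the pair correlation function at the rate `Q^(-1/2)`, uniformly on bounded ranges. -/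
theorem exists_abs_corr_sub_integral_le {m : ℕ} (hm : 0 < m) {K : ℝ} (hK : 0 < K) :
    ∃ C : ℝ, 0 ≤ C ∧ ∀ b : ℤ, IsCoprime b (m : ℤ) → ∀ Q : ℕ, 1 ≤ Q → ∀ L : ℝ, 0 ≤ L → L ≤ K →
      |cumulCorr (fareyMod m b Q) L -
        ∫ x in (0 : ℝ)..L, gCoprime m (Nat.totient m * x)| ≤ C * (√Q)⁻¹ ∧
      |pairCorr (fareyMod m b Q) (Set.Icc 0 L) -
        ∫ x in (0 : ℝ)..L, gCoprime m (Nat.totient m * x)| ≤ C * (√Q)⁻¹ := by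
  have hA := weightDensity_pos hm
  obtain ⟨Q₀, hQ₀, hbig⟩ := card_fareyMod_asymp hm K
  set D : ℕ := ⌈4 * K / weightDensity m⌉₊
  set C₁ : ℝ := 4 * (D * (12 * D ^ 2 + D * (16 + weightDensity m))) / weightDensity m +
        (1 + 2 * K / weightDensity m) * D ^ 2 * (8 * (16 + weightDensity m) / weightDensity m)
  have hC₁ : 0 ≤ C₁ := by positivity
  set G : ℝ → ℝ := fun L => ∫ x in (0 : ℝ)..L, gCoprime m (Nat.totient m * x) with hG
  have hint : ∀ a c, 0 ≤ a → 0 ≤ c →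
      IntervalIntegrable (fun x => gCoprime m (Nat.totient m * x)) volume a c := by
    intro a c ha hc
    refine ((continuousOn_gCoprime hm).mono fun x hx => ?_).intervalIntegrable
    exact (le_min ha hc).trans hx.1
  have hG0 : ∀ L, 0 ≤ L → 0 ≤ G L := fun L hL =>
    intervalIntegral.integral_nonneg hL fun x hx => gCoprime_nonneg hm hx.1
  have hGK : ∀ L, 0 ≤ L → L ≤ K → G L ≤ G K := by
    intro L hL hLK
    have h1 := intervalIntegral.integral_add_adjacent_intervals (hint 0 L le_rfl hL)
      (hint L K hL hK.le)
    have h2 : 0 ≤ ∫ x in L..K, gCoprime m (Nat.totient m * x) :=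
      intervalIntegral.integral_nonneg hLK fun x hx => gCoprime_nonneg hm (hL.trans hx.1)
    simp only [hG]
    linarith
  have hGK0 := hG0 K hK.le
  -- Absorbs the finitely many Q < Q₀, where the counts are at most Q₀² and the integral at most G
  -- K.
  set C₂ : ℝ := ((Q₀ : ℝ) ^ 2 + G K) * √Q₀
  have hC₂ : 0 ≤ C₂ := by positivity
  refine ⟨C₁ + C₂, by positivity, fun b hb Q hQ L hL hLK => ?_⟩
  have hQ1 : (1 : ℝ) ≤ Q := by exact_mod_cast hQ
  have hs : 0 < √(Q : ℝ) := Real.sqrt_pos.2 (by linarith)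
  rcases le_or_gt Q₀ Q with h | h
  · obtain ⟨h1, h2, h3⟩ := hbig b hb Q h
    have hLQ : L * Q < (fareyMod m b Q).card := lt_of_le_of_lt (by gcongr) h3
    rw [pairCorr_Icc_eq_cumulCorr hL hLQ, and_self]
    have hle : C₁ * (√(Q : ℝ))⁻¹ ≤ (C₁ + C₂) * (√Q)⁻¹ := by gcongr; linarith
    rcases hL.eq_or_lt with rfl | hL0
    · have : cumulCorr (fareyMod m b Q) 0 = 0 := by
        rw [cumulCorr, show {p : ℝ × ℝ | p.1 ∈ fareyMod m b Q ∧ p.2 ∈ fareyMod m b Q ∧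
          0 < p.2 - p.1 ∧ p.2 - p.1 ≤ 0 / ((fareyMod m b Q).card : ℝ)} = ∅ from ?_]
        · simp
        · refine Set.eq_empty_iff_forall_notMem.2 fun p hp => ?_
          have h1 := hp.2.2.1
          have h2 := hp.2.2.2
          rw [zero_div] at h2
          linarith
      rw [this, intervalIntegral.integral_same, sub_zero, abs_zero]
      positivity
    · exact (abs_ncard_close_pairs_div_sub_le hm hb hQ hL0 hLK h1 h2 hLQ (Nat.le_ceil _)).trans hle
  · have hcard : ((fareyMod m b Q).card : ℝ) ≤ (Q₀ : ℝ) ^ 2 := by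
      have h1 := (card_fareyMod_le m b Q).trans (Nat.pow_le_pow_left h.le 2)
      exact_mod_cast h1
    have hbound : (Q₀ : ℝ) ^ 2 + G K ≤ (C₁ + C₂) * (√Q)⁻¹ := by
      have h1 : √(Q : ℝ) ≤ √Q₀ := Real.sqrt_le_sqrt (by exact_mod_cast h.le)
      rw [← div_eq_mul_inv, le_div_iff₀ hs]
      calc ((Q₀ : ℝ) ^ 2 + G K) * √Q ≤ C₂ := mul_le_mul_of_nonneg_left h1 (by positivity)
        _ ≤ C₁ + C₂ := by linarith
    have hfin : ∀ x : ℝ, 0 ≤ x → x ≤ (fareyMod m b Q).card →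
        |x - G L| ≤ (C₁ + C₂) * (√Q)⁻¹ := by
      intro x hx0 hx
      refine le_trans ?_ hbound
      have := hG0 L hL
      have := hGK L hL hLK
      rw [abs_le]; constructor <;> nlinarith [sq_nonneg (Q₀ : ℝ)]
    exact ⟨hfin _ (cumulCorr_nonneg _ _) (cumulCorr_le_card _ _),
      hfin _ (pairCorr_nonneg _ _) (pairCorr_le_card _ _)⟩

/-! ### From the intervals [0, L] to all intervals -/

theorem finite_pairs (F : Finset ℝ) (p : ℝ × ℝ → Prop) :
    {x : ℝ × ℝ | x.1 ∈ F ∧ x.2 ∈ F ∧ p x}.Finite := by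
  refine (Finset.finite_toSet (F ×ˢ F)).subset fun x hx => ?_
  simp only [Finset.coe_product, Set.mem_prod, Finset.mem_coe]
  exact ⟨hx.1, hx.2.1⟩

theorem pairCorr_mono (F : Finset ℝ) {I J : Set ℝ} (h : I ⊆ J) :
    pairCorr F I ≤ pairCorr F J := by
  unfold pairCorr
  refine mul_le_mul_of_nonneg_left ?_ (by positivity)
  refine Nat.cast_le.2 (Set.ncard_le_ncard ?_ (finite_pairs F _))
  rintro p ⟨h1, h2, h3, t, ht, hk⟩
  exact ⟨h1, h2, h3, t, h ht, hk⟩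

theorem pairCorr_union_le (F : Finset ℝ) (I J : Set ℝ) :
    pairCorr F (I ∪ J) ≤ pairCorr F I + pairCorr F J := by
  unfold pairCorr
  rw [← mul_add]
  refine mul_le_mul_of_nonneg_left ?_ (by positivity)
  have hsub := Set.ncard_le_ncard (s := {p : ℝ × ℝ | p.1 ∈ F ∧ p.2 ∈ F ∧ p.2 ≠ p.1 ∧
      ∃ t ∈ I ∪ J, ∃ k : ℤ, p.2 - p.1 = t / (F.card : ℝ) + (k : ℝ)})
    (t := {p : ℝ × ℝ | p.1 ∈ F ∧ p.2 ∈ F ∧ p.2 ≠ p.1 ∧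
      ∃ t ∈ I, ∃ k : ℤ, p.2 - p.1 = t / (F.card : ℝ) + (k : ℝ)} ∪
      {p : ℝ × ℝ | p.1 ∈ F ∧ p.2 ∈ F ∧ p.2 ≠ p.1 ∧
      ∃ t ∈ J, ∃ k : ℤ, p.2 - p.1 = t / (F.card : ℝ) + (k : ℝ)}) ?_
      ((finite_pairs F _).union (finite_pairs F _))
  · exact_mod_cast hsub.trans (Set.ncard_union_le _ _)
  · rintro p ⟨h1, h2, h3, t, ht | ht, hk⟩
    · exact Or.inl ⟨h1, h2, h3, t, ht, hk⟩
    · exact Or.inr ⟨h1, h2, h3, t, ht, hk⟩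

/-- Disjoint sets may meet modulo N, so additivity can fail in general. Inside an interval of length
2R < N, the representative t of a difference is unique. -/
theorem pairCorr_add_le {F : Finset ℝ} {I J S : Set ℝ} {R : ℝ} (hI : I ⊆ Set.Icc (-R) R)
    (hJ : J ⊆ Set.Icc (-R) R) (hIJ : Disjoint I J) (hR : 2 * R < F.card) (hIS : I ⊆ S)
    (hJS : J ⊆ S) :
    pairCorr F I + pairCorr F J ≤ pairCorr F S := by
  refine le_trans ?_ (pairCorr_mono F (Set.union_subset hIS hJS))
  unfold pairCorr
  rw [← mul_add]
  refine mul_le_mul_of_nonneg_left ?_ (by positivity)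
  rw [← Nat.cast_add, ← Set.ncard_union_eq ?_ (finite_pairs F _) (finite_pairs F _)]
  · refine Nat.cast_le.2 (Set.ncard_le_ncard ?_ (finite_pairs F _))
    rintro p (⟨h1, h2, h3, t, ht, hk⟩ | ⟨h1, h2, h3, t, ht, hk⟩)
    · exact ⟨h1, h2, h3, t, Or.inl ht, hk⟩
    · exact ⟨h1, h2, h3, t, Or.inr ht, hk⟩
  · rw [Set.disjoint_left]
    rintro p ⟨-, -, -, t, ht, k, hk⟩ ⟨-, -, -, s, hs, l, hl⟩
    have ht' := hI ht
    have hs' := hJ hs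
    have hR0 : 0 ≤ R := by linarith [ht'.1, ht'.2]
    have hN : (0 : ℝ) < F.card := by linarith
    have h1 : t - s = (F.card : ℝ) * ((l - k : ℤ) : ℝ) := by
      have : t / (F.card : ℝ) + k = s / F.card + l := by rw [← hk, ← hl]
      push_cast
      field_simp at this
      linarith
    have hlk : l - k = 0 := by
      have h2 : |((l - k : ℤ) : ℝ)| < 1 := by
        have h3 : |t - s| < F.card := by
          rw [abs_lt]; constructor <;> linarith [ht'.1, ht'.2, hs'.1, hs'.2]
        rw [h1, abs_mul, abs_of_pos hN] at h3
        by_contra hcon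
        nlinarith [not_lt.1 hcon]
      rw [← Int.cast_abs] at h2
      exact Int.abs_lt_one_iff.1 (by exact_mod_cast h2)
    rw [hlk, Int.cast_zero, mul_zero, sub_eq_zero] at h1
    exact Set.disjoint_left.1 hIJ ht (h1 ▸ hs)

/-- Swap the two members of each pair. -/
theorem pairCorr_neg (F : Finset ℝ) (I : Set ℝ) :
    pairCorr F (Neg.neg ⁻¹' I) = pairCorr F I := by
  unfold pairCorr
  congr 2
  refine Set.ncard_congr (fun p _ => (p.2, p.1)) ?_ ?_ ?_
  · rintro p ⟨h1, h2, h3, t, ht, k, hk⟩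
    refine ⟨h2, h1, h3.symm, -t, ht, -k, ?_⟩
    push_cast
    linarith [neg_div (F.card : ℝ) t]
  · rintro ⟨x, y⟩ ⟨x', y'⟩ - - h
    simp only [Prod.mk.injEq] at h ⊢
    exact h.symm
  · rintro ⟨x, y⟩ ⟨h1, h2, h3, t, ht, k, hk⟩
    refine ⟨(y, x), ⟨h2, h1, h3.symm, -t, by simpa using ht, -k, ?_⟩, rfl⟩
    push_cast
    simp only at hk ⊢
    linarith [neg_div (F.card : ℝ) t]

theorem pairCorr_empty (F : Finset ℝ) : pairCorr F ∅ = 0 := by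
  simp [pairCorr]

/-- The even measure on the line with density `g |x|`. -/
noncomputable def evenMeasure (g : ℝ → ℝ) : Measure ℝ :=
  volume.withDensity fun x => ENNReal.ofReal (g |x|)

theorem continuous_comp_abs {g : ℝ → ℝ} (hg : ContinuousOn g (Set.Ici 0)) :
    Continuous fun x => g |x| :=
  hg.comp_continuous continuous_abs fun x => abs_nonneg x

theorem evenMeasure_neg {g : ℝ → ℝ} {S : Set ℝ} (hS : MeasurableSet S) :
    evenMeasure g (Neg.neg ⁻¹' S) = evenMeasure g S := by
  rw [evenMeasure, withDensity_apply _ hS, withDensity_apply _ (measurable_neg hS)]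
  rw [← (Measure.measurePreserving_neg (volume : Measure ℝ)).setLIntegral_comp_preimage_emb
    (MeasurableEquiv.neg ℝ).measurableEmbedding (fun x => ENNReal.ofReal (g |x|)) S]
  simp only [abs_neg]

theorem evenMeasure_eq {g : ℝ → ℝ} (hg : ContinuousOn g (Set.Ici 0))
    (hg0 : ∀ x, 0 ≤ x → 0 ≤ g x) {J : Set ℝ} {c d : ℝ} (hcd : c ≤ d) (h1 : Set.Ioo c d ⊆ J)
    (h2 : J ⊆ Set.Icc c d) :
    evenMeasure g J = ENNReal.ofReal ((∫ x in (0 : ℝ)..d, g |x|) - ∫ x in (0 : ℝ)..c, g |x|) := by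
  have hc := continuous_comp_abs hg
  have hac : evenMeasure g ≪ volume := withDensity_absolutelyContinuous _ _
  have e1 : evenMeasure g (Set.Ioo c d) = evenMeasure g (Set.Ioc c d) :=
    measure_congr (hac.ae_eq Ioo_ae_eq_Ioc)
  have e2 : evenMeasure g (Set.Icc c d) = evenMeasure g (Set.Ioc c d) :=
    measure_congr (hac.ae_eq Ioc_ae_eq_Icc.symm)
  have e3 : evenMeasure g J = evenMeasure g (Set.Ioc c d) :=
    le_antisymm (e2 ▸ measure_mono h2) (e1 ▸ measure_mono h1)
  rw [e3, evenMeasure, withDensity_apply _ measurableSet_Ioc,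
    intervalIntegral.integral_interval_sub_left (hc.intervalIntegrable _ _)
      (hc.intervalIntegrable _ _), intervalIntegral.integral_of_le hcd,
    ofReal_integral_eq_lintegral_ofReal]
  · exact (hc.intervalIntegrable c d).1
  · exact Eventually.of_forall fun x => hg0 _ (abs_nonneg x)

section Limit

variable {F : ℕ → Finset ℝ} {g : ℝ → ℝ}

theorem tendsto_pairCorr_Icc_zero
    (hlim : ∀ L, 0 ≤ L → Tendsto (fun n => pairCorr (F n) (Set.Icc 0 L)) atTop
      (𝓝 (∫ x in (0 : ℝ)..L, g |x|))) (x : ℝ) :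
    Tendsto (fun n => pairCorr (F n) (Set.Icc 0 x)) atTop
      (𝓝 (∫ x in (0 : ℝ)..(max x 0), g |x|)) := by
  rcases le_or_gt 0 x with h | h
  · rw [max_eq_left h]; exact hlim x h
  · rw [max_eq_right h.le, Set.Icc_eq_empty (not_le.2 h)]
    simp [pairCorr_empty]

/-- Squeeze: [0, y] ⊆ [0, c] ∪ J for y < d bounds the count of J below, and the disjoint sets [0,
x], J inside [0, d] with x < c bound it above. Continuity of the primitive lets y → d and x → c, so
end points do not matter. -/
theorem tendsto_pairCorr_of_subset (hg : ContinuousOn g (Set.Ici 0))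
    (hN : Tendsto (fun n => ((F n).card : ℝ)) atTop atTop)
    (hlim : ∀ L, 0 ≤ L → Tendsto (fun n => pairCorr (F n) (Set.Icc 0 L)) atTop
      (𝓝 (∫ x in (0 : ℝ)..L, g |x|))) {J : Set ℝ} {c d : ℝ} (hc : 0 ≤ c) (hcd : c ≤ d)
    (h1 : Set.Ioo c d ⊆ J) (h2 : J ⊆ Set.Icc c d) :
    Tendsto (fun n => pairCorr (F n) J) atTop
      (𝓝 ((∫ x in (0 : ℝ)..d, g |x|) - ∫ x in (0 : ℝ)..c, g |x|)) := by
  -- Extended by 0 to negative arguments, so that x < c remains possible when c = 0.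
  set H : ℝ → ℝ := fun x => ∫ t in (0 : ℝ)..(max x 0), g |t| with hH
  have hcont : Continuous H := by
    have := intervalIntegral.continuous_primitive
      (fun a b => (continuous_comp_abs hg).intervalIntegrable (μ := volume) a b) 0
    exact this.comp (continuous_id.max continuous_const)
  have hHlim := tendsto_pairCorr_Icc_zero hlim
  have ed : ∫ x in (0 : ℝ)..d, g |x| = H d := by simp only [hH, max_eq_left (hc.trans hcd)]
  have ec : ∫ x in (0 : ℝ)..c, g |x| = H c := by simp only [hH, max_eq_left hc]
  rw [ed, ec, tendsto_order]
  constructor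
  · intro a ha
    obtain ⟨y, hy1, hy2⟩ : ∃ y, a < H y - H c ∧ y < d := by
      have hev : ∀ᶠ y in 𝓝[<] d, a < H y - H c :=
        ((hcont.sub continuous_const).continuousAt.eventually (lt_mem_nhds ha)).filter_mono
          nhdsWithin_le_nhds
      exact (hev.and self_mem_nhdsWithin).exists
    filter_upwards [((hHlim y).sub (hHlim c)).eventually (lt_mem_nhds hy1)] with n hn
    have hsub : Set.Icc 0 y ⊆ Set.Icc 0 c ∪ J := by
      intro t ht
      rcases le_or_gt t c with h | h
      · exact Or.inl ⟨ht.1, h⟩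
      · exact Or.inr (h1 ⟨h, ht.2.trans_lt hy2⟩)
    have := (pairCorr_mono (F n) hsub).trans (pairCorr_union_le (F n) _ _)
    linarith
  · intro a ha
    obtain ⟨x, hx1, hx2⟩ : ∃ x, H d - H x < a ∧ x < c := by
      have hev : ∀ᶠ x in 𝓝[<] c, H d - H x < a :=
        ((continuous_const.sub hcont).continuousAt.eventually (gt_mem_nhds ha)).filter_mono
          nhdsWithin_le_nhds
      exact (hev.and self_mem_nhdsWithin).exists
    filter_upwards [((hHlim d).sub (hHlim x)).eventually (gt_mem_nhds hx1),
      hN.eventually_gt_atTop (2 * d)] with n hn hNn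
    have hd : 0 ≤ d := hc.trans hcd
    have hJd : J ⊆ Set.Icc 0 d := fun t ht => ⟨hc.trans (h2 ht).1, (h2 ht).2⟩
    have hxd : Set.Icc 0 x ⊆ Set.Icc 0 d := Set.Icc_subset_Icc_right (hx2.le.trans hcd)
    have hdd : Set.Icc 0 d ⊆ Set.Icc (-d) d := Set.Icc_subset_Icc_left (by linarith)
    have hdis : Disjoint (Set.Icc 0 x) J := Set.disjoint_left.2 fun t ht ht' =>
      absurd (ht.2.trans_lt hx2) (not_lt.2 (h2 ht').1)
    have := pairCorr_add_le (hxd.trans hdd) (hJd.trans hdd) hdis hNn hxd hJd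
    linarith

theorem tendsto_ofReal_pairCorr_of_nonneg (hg : ContinuousOn g (Set.Ici 0))
    (hg0 : ∀ x, 0 ≤ x → 0 ≤ g x)
    (hN : Tendsto (fun n => ((F n).card : ℝ)) atTop atTop)
    (hlim : ∀ L, 0 ≤ L → Tendsto (fun n => pairCorr (F n) (Set.Icc 0 L)) atTop
      (𝓝 (∫ x in (0 : ℝ)..L, g |x|))) {J : Set ℝ} (hJ : J.OrdConnected) (hJ0 : J ⊆ Set.Ici 0)
    (hb : BddAbove J) :
    Tendsto (fun n => ENNReal.ofReal (pairCorr (F n) J)) atTop (𝓝 (evenMeasure g J)) := by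
  rcases J.eq_empty_or_nonempty with rfl | hne
  · simp [pairCorr_empty]
  have hbb : BddBelow J := ⟨0, fun x hx => hJ0 hx⟩
  have h2 : J ⊆ Set.Icc (sInf J) (sSup J) := fun x hx => ⟨csInf_le hbb hx, le_csSup hb hx⟩
  have h1 : Set.Ioo (sInf J) (sSup J) ⊆ J := by
    intro x hx
    obtain ⟨y, hy, hyx⟩ := exists_lt_of_csInf_lt hne hx.1
    obtain ⟨z, hz, hxz⟩ := exists_lt_of_lt_csSup hne hx.2
    exact hJ.out hy hz ⟨hyx.le, hxz.le⟩
  have hc : 0 ≤ sInf J := le_csInf hne fun x hx => hJ0 hx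
  have hcd : sInf J ≤ sSup J := by
    obtain ⟨x, hx⟩ := hne
    exact (h2 hx).1.trans (h2 hx).2
  rw [evenMeasure_eq hg hg0 hcd h1 h2]
  exact ENNReal.tendsto_ofReal (tendsto_pairCorr_of_subset hg hN hlim hc hcd h1 h2)

/-- J contains every [a, d] for some a > 0, and the limits on these are unbounded in d, so both the
measure of J and the limit of the counts are infinite. -/
theorem tendsto_ofReal_pairCorr_of_not_bddAbove (hg : ContinuousOn g (Set.Ici 0))
    (hg0 : ∀ x, 0 ≤ x → 0 ≤ g x)
    (hN : Tendsto (fun n => ((F n).card : ℝ)) atTop atTop)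
    (hlim : ∀ L, 0 ≤ L → Tendsto (fun n => pairCorr (F n) (Set.Icc 0 L)) atTop
      (𝓝 (∫ x in (0 : ℝ)..L, g |x|)))
    (hinf : Tendsto (fun L => ∫ x in (0 : ℝ)..L, g |x|) atTop atTop)
    {J : Set ℝ} (hJ : J.OrdConnected) (hb : ¬ BddAbove J) :
    Tendsto (fun n => ENNReal.ofReal (pairCorr (F n) J)) atTop (𝓝 (evenMeasure g J)) := by
  obtain ⟨a, ha, ha0⟩ : ∃ a ∈ J, 0 < a := not_bddAbove_iff.1 hb 0
  have hsub : ∀ d, Set.Icc a d ⊆ J := by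
    intro d x hx
    obtain ⟨z, hz, hdz⟩ := not_bddAbove_iff.1 hb d
    exact hJ.out ha hz ⟨hx.1, hx.2.trans hdz.le⟩
  have hbig : ∀ r : NNReal, ∃ d, a ≤ d ∧
      (r : ℝ) < (∫ x in (0 : ℝ)..d, g |x|) - ∫ x in (0 : ℝ)..a, g |x| := by
    intro r
    obtain ⟨d, hd1, hd2⟩ := ((hinf.eventually_gt_atTop
      (r + ∫ x in (0 : ℝ)..a, g |x|)).and (eventually_ge_atTop a)).exists
    exact ⟨d, hd2, by linarith⟩
  have htop : evenMeasure g J = ⊤ := by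
    refine ENNReal.eq_top_of_forall_nnreal_le fun r => ?_
    obtain ⟨d, had, hd⟩ := hbig r
    refine le_trans ?_ (measure_mono (hsub d))
    rw [evenMeasure_eq hg hg0 had Set.Ioo_subset_Icc_self subset_rfl]
    rw [← ENNReal.ofReal_coe_nnreal]
    exact ENNReal.ofReal_le_ofReal hd.le
  rw [htop, ENNReal.tendsto_nhds_top_iff_nnreal]
  intro r
  obtain ⟨d, had, hd⟩ := hbig r
  filter_upwards [(tendsto_pairCorr_of_subset hg hN hlim ha0.le had Set.Ioo_subset_Icc_self
    subset_rfl).eventually (lt_mem_nhds hd)] with n hn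
  have hlt := hn.trans_le (pairCorr_mono (F n) (hsub d))
  rw [← ENNReal.ofReal_coe_nnreal]
  exact (ENNReal.ofReal_lt_ofReal_iff (lt_of_le_of_lt r.coe_nonneg hlt)).2 hlt

theorem ordConnected_neg_preimage {I : Set ℝ} (hI : I.OrdConnected) :
    (Neg.neg ⁻¹' I : Set ℝ).OrdConnected :=
  ⟨fun _ hx _ hy _ hz => hI.out hy hx ⟨neg_le_neg hz.2, neg_le_neg hz.1⟩⟩

/-- A sequence of finite sets whose correlation counts of `[0, L]` converge to `∫_0^L g`, with `g`
continuous, nonnegative and of infinite integral, has pair correlation function `g`. -/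
theorem hasPairCorrFunction_of_tendsto (hg : ContinuousOn g (Set.Ici 0))
    (hg0 : ∀ x, 0 ≤ x → 0 ≤ g x)
    (hN : Tendsto (fun n => ((F n).card : ℝ)) atTop atTop)
    (hlim : ∀ L, 0 ≤ L → Tendsto (fun n => pairCorr (F n) (Set.Icc 0 L)) atTop
      (𝓝 (∫ x in (0 : ℝ)..L, g x)))
    (hinf : Tendsto (fun L => ∫ x in (0 : ℝ)..L, g x) atTop atTop) :
    HasPairCorrFunction F g := by
  have heq : ∀ L, 0 ≤ L → ∫ x in (0 : ℝ)..L, g |x| = ∫ x in (0 : ℝ)..L, g x := by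
    intro L hL
    refine intervalIntegral.integral_congr fun x hx => ?_
    rw [Set.uIcc_of_le hL] at hx
    simp only [abs_of_nonneg hx.1]
  have hlim' : ∀ L, 0 ≤ L → Tendsto (fun n => pairCorr (F n) (Set.Icc 0 L)) atTop
      (𝓝 (∫ x in (0 : ℝ)..L, g |x|)) := fun L hL => by rw [heq L hL]; exact hlim L hL
  have hinf' : Tendsto (fun L => ∫ x in (0 : ℝ)..L, g |x|) atTop atTop :=
    hinf.congr' ((eventually_ge_atTop 0).mono fun L hL => (heq L hL).symm)
  refine ⟨evenMeasure g, ?_, ?_⟩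
  · intro I hI
    have hneg : ∀ J : Set ℝ, J.OrdConnected →
        Tendsto (fun n => ENNReal.ofReal (pairCorr (F n) (Neg.neg ⁻¹' J))) atTop
          (𝓝 (evenMeasure g (Neg.neg ⁻¹' J))) →
        Tendsto (fun n => ENNReal.ofReal (pairCorr (F n) J)) atTop (𝓝 (evenMeasure g J)) := by
      intro J hJ h
      simpa only [pairCorr_neg, evenMeasure_neg hJ.measurableSet] using h
    by_cases hb : BddAbove I
    · by_cases hb' : BddBelow I
      · set I₁ := I ∩ Set.Ici 0 with hI₁
        set I₂ := I ∩ Set.Iio 0 with hI₂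
        have hc₁ : I₁.OrdConnected := hI.inter Set.ordConnected_Ici
        have hc₂ : I₂.OrdConnected := hI.inter Set.ordConnected_Iio
        have hdis : Disjoint I₁ I₂ := Set.disjoint_left.2 fun x hx hx' =>
          not_lt.2 (Set.mem_Ici.1 hx.2) (Set.mem_Iio.1 hx'.2)
        have hun : I₁ ∪ I₂ = I := by
          rw [hI₁, hI₂, ← Set.inter_union_distrib_left, Set.Ici_union_Iio, Set.inter_univ]
        have t₁ := tendsto_ofReal_pairCorr_of_nonneg hg hg0 hN hlim' hc₁
          Set.inter_subset_right (hb.mono Set.inter_subset_left)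
        have t₂ : Tendsto (fun n => ENNReal.ofReal (pairCorr (F n) I₂)) atTop
            (𝓝 (evenMeasure g I₂)) := by
          refine hneg I₂ hc₂ (tendsto_ofReal_pairCorr_of_nonneg hg hg0 hN hlim'
            (ordConnected_neg_preimage hc₂) ?_ ?_)
          · intro x hx
            have : -x < 0 := hx.2
            exact (neg_lt_zero.1 this).le
          · obtain ⟨a, ha⟩ := hb'
            exact ⟨-a, fun x hx => by linarith [ha hx.1]⟩
        have hmeas : evenMeasure g I = evenMeasure g I₁ + evenMeasure g I₂ := by
          rw [← measure_union hdis hc₂.measurableSet, hun]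
        rw [hmeas]
        refine (t₁.add t₂).congr' ?_
        obtain ⟨a, ha⟩ := hb'
        obtain ⟨c, hc⟩ := hb
        set R := max (-a) c
        have hIR : I ⊆ Set.Icc (-R) R := fun x hx =>
          ⟨by linarith [ha hx, le_max_left (-a) c], (hc hx).trans (le_max_right _ _)⟩
        filter_upwards [hN.eventually_gt_atTop (2 * R)] with n hn
        rw [← ENNReal.ofReal_add (pairCorr_nonneg _ _) (pairCorr_nonneg _ _)]
        congr 1
        -- For bounded `I` the two halves add up exactly as soon as N > 2R.
        refine le_antisymm (pairCorr_add_le (Set.inter_subset_left.trans hIR)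
          (Set.inter_subset_left.trans hIR) hdis hn Set.inter_subset_left
          Set.inter_subset_left) ?_
        have := pairCorr_union_le (F n) I₁ I₂
        rwa [hun] at this
      · refine hneg I hI (tendsto_ofReal_pairCorr_of_not_bddAbove hg hg0 hN hlim' hinf'
          (ordConnected_neg_preimage hI) ?_)
        rintro ⟨a, ha⟩
        refine hb' ⟨-a, fun x hx => ?_⟩
        have : -x ≤ a := ha (by simpa using hx)
        linarith
    · exact tendsto_ofReal_pairCorr_of_not_bddAbove hg hg0 hN hlim' hinf' hI hb
  · intro L hL
    have h := evenMeasure_eq hg hg0 hL Set.Ioo_subset_Icc_self subset_rfl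
    rw [intervalIntegral.integral_same, sub_zero, heq L hL] at h
    refine ⟨h ▸ ENNReal.ofReal_lt_top, ?_, ?_⟩
    · refine (hg.mono fun x hx => ?_).intervalIntegrable
      rw [Set.uIcc_of_le hL] at hx
      exact hx.1
    · rw [h, ENNReal.toReal_ofReal]
      exact intervalIntegral.integral_nonneg hL fun x hx => hg0 x hx.1

end Limit

/-! ### Divergence of the integral of g, and the theorem -/

theorem logPrim_mono : Monotone logPrim := by
  intro y z h
  have e : logPrim z - logPrim y = ∫ x in y..z, logKernel x := by
    rw [logPrim, logPrim, intervalIntegral.integral_interval_sub_left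
      (continuous_logKernel.intervalIntegrable _ _) (continuous_logKernel.intervalIntegrable _ _)]
  have := intervalIntegral.integral_nonneg (μ := volume) h fun x _ => logKernel_nonneg x
  linarith

theorem logPrim_three_pos : 0 < logPrim 3 := by
  rw [logPrim_of_one_le (by norm_num)]
  have := Real.log_lt_sub_one_of_pos (x := 3) (by norm_num) (by norm_num)
  linarith

theorem logPrim_nonneg (y : ℝ) : 0 ≤ logPrim y := by
  rw [← logPrim_of_le_one (min_le_right y 1)]
  exact logPrim_mono (min_le_left y 1)

theorem one_div_le_pairWeight {m Δ : ℕ} (hm : 0 < m) (hΔ : 0 < Δ) :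
    1 / (Δ : ℝ) ≤ pairWeight m Δ := by
  have hΔR : (0 : ℝ) < Δ := by exact_mod_cast hΔ
  have h := pairWeight_eq hm hΔ
  have hg : 0 < Nat.gcd Δ m := Nat.gcd_pos_of_pos_left _ hΔ
  have h1 : (1 : ℝ) ≤ Nat.totient Δ := by exact_mod_cast Nat.totient_pos.2 hΔ
  have h2 : (1 : ℝ) ≤ (Nat.gcd Δ m : ℝ) / Nat.totient (Nat.gcd Δ m) := by
    rw [one_le_div (by exact_mod_cast Nat.totient_pos.2 hg)]
    exact_mod_cast Nat.totient_le _
  rw [div_le_iff₀ hΔR]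
  nlinarith

/-- Each Δ ≤ 2L/(3A) contributes at least a constant times `logPrim 3`/Δ, and the harmonic series
diverges. The number 3 could be any real above 1. -/
theorem tendsto_integral_gCoprime {m : ℕ} (hm : 0 < m) :
    Tendsto (fun L : ℝ => ∫ x in (0 : ℝ)..L, gCoprime m (Nat.totient m * x)) atTop atTop := by
  have hA := weightDensity_pos hm
  set A := weightDensity m with hAdef
  have hmR : (0 : ℝ) < m := by exact_mod_cast hm
  have hk := logPrim_three_pos
  have hharm : Tendsto (fun M : ℕ => ∑ Δ ∈ Finset.Icc 1 M, 1 / (Δ : ℝ)) atTop atTop := by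
    refine Real.tendsto_sum_range_one_div_nat_succ_atTop.congr fun M => ?_
    rw [Finset.range_eq_Ico]
    have := Finset.sum_Ico_add' (fun i : ℕ => 1 / (i : ℝ)) 0 M 1
    push_cast at this
    rw [this]
    rfl
  have hfloor : Tendsto (fun L : ℝ => ⌊2 * L / (3 * A)⌋₊) atTop atTop := by
    refine tendsto_nat_floor_atTop.comp ?_
    refine Tendsto.congr (fun L => ?_) (tendsto_id.const_mul_atTop
      (by positivity : (0 : ℝ) < 2 / (3 * A)))
    simp only [id]; ring
  have hmain := (hharm.comp hfloor).const_mul_atTop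
    (mul_pos (div_pos two_pos hmR) hk)
  refine tendsto_atTop_mono' _ ?_ hmain
  filter_upwards [eventually_ge_atTop 0] with L hL
  rw [integral_gCoprime hm hL (Nat.le_ceil _), ← hAdef]
  simp only [Function.comp]
  rw [mul_assoc]
  refine mul_le_mul_of_nonneg_left ?_ (by positivity)
  rw [Finset.mul_sum]
  have hsub : Finset.Icc 1 ⌊2 * L / (3 * A)⌋₊ ⊆ Finset.Icc 1 ⌈2 * L / A⌉₊ := by
    refine Finset.Icc_subset_Icc_right (Nat.floor_le_of_le (le_trans ?_ (Nat.le_ceil _)))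
    gcongr
    linarith
  refine le_trans (Finset.sum_le_sum fun Δ hΔ => ?_)
    (Finset.sum_le_sum_of_subset_of_nonneg hsub fun Δ hΔ _ => ?_)
  · rw [Finset.mem_Icc] at hΔ
    have hΔR : (0 : ℝ) < Δ := by exact_mod_cast hΔ.1
    have h1 := (Nat.le_floor_iff (by positivity)).1 hΔ.2
    rw [le_div_iff₀ (by positivity)] at h1
    have h3 : 3 ≤ 2 * L / (A * Δ) := by
      rw [le_div_iff₀ (by positivity)]; linarith
    rw [mul_comm]
    exact mul_le_mul (one_div_le_pairWeight hm hΔ.1) (logPrim_mono h3) hk.le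
      (pairWeight_nonneg hm hΔ.1)
  · exact mul_nonneg (pairWeight_nonneg hm (Finset.mem_Icc.1 hΔ).1) (logPrim_nonneg _)

theorem tendsto_card_fareyMod {m : ℕ} (hm : 0 < m) {b : ℤ} (hb : IsCoprime b (m : ℤ)) :
    Tendsto (fun Q => ((fareyMod m b Q).card : ℝ)) atTop atTop := by
  obtain ⟨Q₀, -, h⟩ := card_fareyMod_asymp hm 1
  refine tendsto_atTop_mono' _ ?_ (tendsto_natCast_atTop_atTop (R := ℝ))
  filter_upwards [eventually_ge_atTop Q₀] with Q hQ
  have := (h b hb Q hQ).2.2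
  linarith

theorem hasPairCorrFunction_fareyMod {m : ℕ} (hm : 0 < m) {b : ℤ} (hb : IsCoprime b (m : ℤ)) :
    HasPairCorrFunction (fareyMod m b) fun x => gCoprime m ((Nat.totient m : ℝ) * x) := by
  refine hasPairCorrFunction_of_tendsto (continuousOn_gCoprime hm)
    (fun x hx => gCoprime_nonneg hm hx) (tendsto_card_fareyMod hm hb) (fun L hL => ?_)
    (tendsto_integral_gCoprime hm)
  -- The bound `L + 1` rather than `L`, because K must be positive even for L = 0.
  obtain ⟨C, -, h⟩ := exists_abs_corr_sub_integral_le hm (K := L + 1) (by linarith)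
  rw [tendsto_iff_norm_sub_tendsto_zero]
  have hz : Tendsto (fun Q : ℕ => C * (√(Q : ℝ))⁻¹) atTop (𝓝 0) := by
    have h1 : Tendsto (fun Q : ℕ => √(Q : ℝ)) atTop atTop :=
      Real.tendsto_sqrt_atTop.comp tendsto_natCast_atTop_atTop
    simpa using h1.inv_tendsto_atTop.const_mul C
  refine squeeze_zero' (Eventually.of_forall fun _ => norm_nonneg _) ?_ hz
  filter_upwards [eventually_ge_atTop 1] with Q hQ
  exact (h b hb Q hQ L hL (by linarith)).2

theorem inv_sqrt_le_rpow {Q : ℕ} (hQ : 1 ≤ Q) {δ : ℝ} (hδ : 0 < δ) :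
    (√(Q : ℝ))⁻¹ ≤ (Q : ℝ) ^ (-(1 / 2 : ℝ) + δ) := by
  rw [Real.sqrt_eq_rpow, ← Real.rpow_neg (Nat.cast_nonneg Q)]
  exact Real.rpow_le_rpow_of_exponent_le (by exact_mod_cast hQ) (by linarith)

end FareyPair

theorem theorem2 (m : ℕ) (hm : 0 < m) :
    (∀ b : ℤ, IsCoprime b (m : ℤ) →
      FareyPair.HasPairCorrFunction (FareyPair.fareyMod m b)
        (fun x => FareyPair.gCoprime m ((Nat.totient m : ℝ) * x))) ∧
    (∀ δ : ℝ, 0 < δ → ∀ K : ℝ, 0 < K → ∃ C : ℝ, ∀ b : ℤ, IsCoprime b (m : ℤ) →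
      ∀ Q : ℕ, 1 ≤ Q → ∀ L : ℝ, 0 ≤ L → L ≤ K →
        |FareyPair.cumulCorr (FareyPair.fareyMod m b Q) L -
            ∫ x in (0 : ℝ)..L, FareyPair.gCoprime m ((Nat.totient m : ℝ) * x)|
          ≤ C * (Q : ℝ) ^ (-(1 / 2 : ℝ) + δ) ∧
        |FareyPair.pairCorr (FareyPair.fareyMod m b Q) (Set.Icc 0 L) -
            ∫ x in (0 : ℝ)..L, FareyPair.gCoprime m ((Nat.totient m : ℝ) * x)|
          ≤ C * (Q : ℝ) ^ (-(1 / 2 : ℝ) + δ)) := by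
  refine ⟨fun b hb => FareyPair.hasPairCorrFunction_fareyMod hm hb, fun δ hδ K hK => ?_⟩
  obtain ⟨C, hC, h⟩ := FareyPair.exists_abs_corr_sub_integral_le hm hK
  refine ⟨C, fun b hb Q hQ L hL hLK => ?_⟩
  have hle := mul_le_mul_of_nonneg_left (FareyPair.inv_sqrt_le_rpow hQ hδ) hC
  obtain ⟨h1, h2⟩ := h b hb Q hQ L hL hLK
  exact ⟨h1.trans hle, h2.trans hle⟩
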